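/- Let $k$ be a field, $Q = k[x_1,\dots,x_n]$, let $m_1,\dots,m_r$ be monomials in $Q$ and $I = \langle m_1,\dots,m_r\rangle$. For $S \subseteq [r] = \{1,\dots,r\}$ put $m_S = \operatorname{lcm}(m_s : s \in S)$ (so $m_\emptyset = 1$). Let $\mathbf T$ be the Taylor complex: $T_l$ is the free $Q$-module with basis $\{\varepsilon_S : S \subseteq [r],\ |S| = l\}$, and the differential is $$\tau(\varepsilon_S) = \sum_{i=1}^{p} (-1)^{p-i}\, \frac{m_S}{m_{S \setminus s_i}}\, \varepsilon_{S \setminus s_i}, \qquad S = \{s_1 < \dots < s_p\}.$$ Let $a_1,\dots,a_c$ be a regular sequence in $Q$ contained in $I$, with chosen expressions $a_i = \sum_{j=1}^r f_{i,j} m_j$, $f_{i,j} \in Q$, and let $R = Q/\langle a_1,\dots,a_c\rangle$. For $u \in \mathbb N^c$ write $|u| = u_1 + \dots + u_c$, and let $e_1,\dots,e_c$ be the standard basis vectors. Define $\sigma_0 = \tau$, $$\sigma_{e_i}(\varepsilon_S) = \sum_{t \in [r] \setminus S} (-1)^{|S| - p_{t,S} - 1}\, \frac{f_{i,t}\, m_t\,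 m_S}{m_{S \cup t}}\, \varepsilon_{S \cup t},$$ where $p_{t,S}$ is the position of $t$ in $S \cup \{t\}$ listed in increasing order (starting from $1$), and $\sigma_u = 0$ for $|u| \ge 2$. Then the maps $\sigma_u$ form a system of higher homotopies for $a_1,\dots,a_c$ on $\mathbf T$. That is: $\mathbf T$ is a complex of free $Q$-modules; each $\sigma_u$ is $Q$-linear and homogeneous of homological degree $2|u| - 1$; $\sigma_0$ is the differential of $\mathbf T$; $\sigma_0\sigma_{e_j} + \sigma_{e_j}\sigma_0$ is multiplication by $a_j$ for each $j$; and $\sum_{b + b' = u} \sigma_b \sigma_{b'} = 0$ whenever $|u| \ge 2$. Consequently the Eisenbud–Shamash construction $\Phi(\mathbf T)$ is a free resolution of $R/IR$ over $R$. Here $\Phi(\mathbf T) = Q\{y_1,\dots,y_c\} \otimes_Q \mathbf T \otimes_Q R$, where $Q\{y_1,\dots,y_c\}$ is the divided power algebra, i.e. the free $Q$-module on the divided power monomials $y^{(v)}$, $v \in \mathbb N^c$; the summand $y^{(v)} \otimes T_l \otimes R$ has homological degree $2|v| + l$, and the differential $\varphi = \sum_u t^u \otimes \sigma_u \otimes R$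 is given by $$\varphi\big(y^{(v)} \otimes g \otimes 1\big) = \sum_{u + w = v} y^{(w)} \otimes \sigma_u(g) \otimes 1 .$$ -/

import Mathlib

open scoped TensorProduct

noncomputable section

namespace TaylorCI

section Complexes

variable {R : Type*} [CommRing R] {F : Type*} [AddCommGroup F] [Module R F]

/-- `f` is homogeneous of degree `p` for the grading `ℱ`. -/
def HasDegree (ℱ : ℤ → Submodule R F) (f : Module.End R F) (p : ℤ) : Prop :=
  ∀ i : ℤ, ∀ x ∈ ℱ i, f x ∈ ℱ (i + p)

/-- A (homologically graded) complex of free `R`-modules, given as the total module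
`F = ⨁ i, ℱ i` with a differential `d` of degree `-1`. -/
structure IsFreeComplex (ℱ : ℤ → Submodule R F) (d : Module.End R F) : Prop where
  internal : DirectSum.IsInternal ℱ
  free : ∀ i, Module.Free R (ℱ i)
  degree : HasDegree ℱ d (-1)
  sq_zero : d * d = 0

/-- The complex `(ℱ, d)` is a free resolution of the `R`-module `N`:
`⋯ → ℱ 2 → ℱ 1 → ℱ 0 → N → 0` is exact for some augmentation `ε : ℱ 0 → N`. -/
structure IsFreeResolution (ℱ : ℤ → Submodule R F) (d : Module.End R F)
    (N : Type*) [AddCommGroup N] [Module R N] : Prop extends IsFreeComplex ℱ d where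
  bounded : ∀ i < 0, ℱ i = ⊥
  exact_pos : ∀ i > 0, ∀ x ∈ ℱ i, d x = 0 → ∃ y ∈ ℱ (i + 1), d y = x
  augmentation : ∃ ε : ℱ 0 →ₗ[R] N, Function.Surjective ε ∧
    ∀ x : ℱ 0, ε x = 0 ↔ ∃ y ∈ ℱ 1, d y = (x : F)

end Complexes

section Homotopies

variable {Q : Type*} [CommRing Q] {c : ℕ} {G : Type*} [AddCommGroup G] [Module Q G]

/-- `σ` is a system of higher homotopies for `a₁, …, a_c` on the complex `(𝒢, d)` of free
`Q`-modules. Multi-indices are elements of `Fin c →₀ ℕ`, with `|u| = u.degree`; the product of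
`Module.End Q G` is composition. -/
structure IsSystemOfHigherHomotopies (a : Fin c → Q) (𝒢 : ℤ → Submodule Q G)
    (d : Module.End Q G) (σ : (Fin c →₀ ℕ) → Module.End Q G) : Prop where
  isFreeComplex : IsFreeComplex 𝒢 d
  degree : ∀ u, HasDegree 𝒢 (σ u) (2 * (u.degree : ℤ) - 1)
  zero : σ 0 = d
  single : ∀ j : Fin c,
    σ 0 * σ (Finsupp.single j 1) + σ (Finsupp.single j 1) * σ 0 = a j • (1 : Module.End Q G)
  higher : ∀ u : Fin c →₀ ℕ, 2 ≤ u.degree →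
    ∑ b ∈ Finset.HasAntidiagonal.antidiagonal u, σ b.1 * σ b.2 = 0

/-- The underlying module of the divided power algebra `Q{y₁, …, y_c}`: the free `Q`-module on the
divided power monomials `y^(v) = y₁^(v₁) ⋯ y_c^(v_c)`, `v ∈ ℕ^c`. -/
abbrev DividedPowers (Q : Type*) [CommRing Q] (c : ℕ) : Type _ := (Fin c →₀ ℕ) →₀ Q

/-- The divided power monomial `y^(v)`. -/
def divPow (Q : Type*) [CommRing Q] {c : ℕ} (v : Fin c →₀ ℕ) : DividedPowers Q c :=
  Finsupp.single v 1

/-- The map `∑ᵤ t^u ⊗ σ_u` on `Q{y₁, …, y_c} ⊗ G`. As `t^u y^(v)` is `y^(v - u)` when `u ≤ v` and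
`0` otherwise, it sends `y^(v) ⊗ g` to the sum of the `y^(w) ⊗ σ_u g` over `u + w = v`. -/
def totalMap (σ : (Fin c →₀ ℕ) → Module.End Q G) :
    Module.End Q (DividedPowers Q c ⊗[Q] G) :=
  TensorProduct.lift <| Finsupp.linearCombination Q fun v : Fin c →₀ ℕ =>
    ∑ p ∈ Finset.HasAntidiagonal.antidiagonal v,
      (TensorProduct.mk Q (DividedPowers Q c) G (divPow Q p.2)) ∘ₗ σ p.1

/-- The underlying `R`-module `Φ(G) = Q{y₁, …, y_c} ⊗ G ⊗ R` of the Eisenbud–Shamash construction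
(with the factor `R` written first). -/
abbrev Shamash (R : Type*) [CommRing R] [Algebra Q R] (c : ℕ) (G : Type*) [AddCommGroup G]
    [Module Q G] : Type _ :=
  R ⊗[Q] (DividedPowers Q c ⊗[Q] G)

/-- The homological grading of `Φ(G)`: each `y_j` has degree `2`, so `y^(v) ⊗ G_i ⊗ R` sits in
degree `2|v| + i`. -/
def shamashGrading (R : Type*) [CommRing R] [Algebra Q R] (c : ℕ) (𝒢 : ℤ → Submodule Q G) (l : ℤ) :
    Submodule R (Shamash (Q := Q) R c G) :=
  Submodule.span R {x | ∃ (v : Fin c →₀ ℕ) (i : ℤ) (g : G), g ∈ 𝒢 i ∧ 2 * (v.degree : ℤ) + i = l ∧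
    x = (1 : R) ⊗ₜ[Q] (divPow Q v ⊗ₜ[Q] g)}

/-- The differential `φ = ∑ᵤ t^u ⊗ σ_u ⊗ R` of the Eisenbud–Shamash construction. -/
def shamashDifferential (R : Type*) [CommRing R] [Algebra Q R]
    (σ : (Fin c →₀ ℕ) → Module.End Q G) : Module.End R (Shamash (Q := Q) R c G) :=
  (totalMap σ).baseChange R

end Homotopies

section Taylor

variable {k : Type*} [Field k] {n r c : ℕ}

/-- The monomial `x^e` of `k[x₁, …, x_n]`. -/
def mono (k : Type*) [Field k] {n : ℕ} (e : Fin n →₀ ℕ) : MvPolynomial (Fin n) k :=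
  MvPolynomial.monomial e 1

/-- The exponent of `m_S = lcm (m_s : s ∈ S)`, where `m s` is the exponent of the monomial `m_s`. -/
def lcmExp (m : Fin r → Fin n →₀ ℕ) (S : Finset (Fin r)) : Fin n →₀ ℕ := S.sup m

/-- The underlying module of the Taylor complex: free with basis `ε_S`, `S ⊆ [r]`. -/
abbrev Taylor (k : Type*) [Field k] (n r : ℕ) : Type _ :=
  Finset (Fin r) →₀ MvPolynomial (Fin n) k

/-- `T_l` is spanned by the `ε_S` with `|S| = l`. -/
def taylorGrading (k : Type*) [Field k] (n r : ℕ) (l : ℤ) :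
    Submodule (MvPolynomial (Fin n) k) (Taylor k n r) :=
  Finsupp.supported _ _ {S | (S.card : ℤ) = l}

/-- The Taylor differential. For `S = {s₁ < ⋯ < s_p}` the sign `(-1)^(p - i)` of the term of `s_i`
is written as `(-1) ^ #{s ∈ S | s_i < s}`. The difference of exponents is the exponent of
`m_S / m_{S - s}`; it is not truncated, as `m_{S - s}` divides `m_S`. -/
def taylorDifferential (k : Type*) [Field k] (m : Fin r → Fin n →₀ ℕ) :
    Module.End (MvPolynomial (Fin n) k) (Taylor k n r) :=
  Finsupp.linearCombination (MvPolynomial (Fin n) k) fun S : Finset (Fin r) =>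
    ∑ s ∈ S, Finsupp.single (S.erase s)
      ((-1) ^ (S.filter fun q => s < q).card * mono k (lcmExp m S - lcmExp m (S.erase s)))

/-- The map `ε_S ↦ ∑_{t ∉ S} (-1)^(p - p_{t,S} - 1) (f_t m_t m_S / m_{S ∪ t}) ε_{S ∪ t}`, where
`p = |S|` and `p_{t,S}` is the position (counted from `1`) of `t` in `S ∪ t`. The elements of `S`
larger than `t` number `p + 1 - p_{t,S}`, which has the parity of `p - p_{t,S} - 1`. The
difference of exponents is not truncated, as `m_{S ∪ t}` divides `m_t m_S`. -/
def taylorHomotopy (m : Fin r → Fin n →₀ ℕ) (f : Fin r → MvPolynomial (Fin n) k) :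
    Module.End (MvPolynomial (Fin n) k) (Taylor k n r) :=
  Finsupp.linearCombination (MvPolynomial (Fin n) k) fun S : Finset (Fin r) =>
    ∑ t ∈ Sᶜ, Finsupp.single (insert t S)
      ((-1) ^ (S.filter fun q => t < q).card *
        (f t * mono k (m t + lcmExp m S - lcmExp m (insert t S))))

/-- The system `σ_0 = τ`, `σ_{e_i}` the homotopy attached to `f_{i,1}, …, f_{i,r}`, and `σ_u = 0`
for all other `u`. -/
def taylorSystem (m : Fin r → Fin n →₀ ℕ) (f : Fin c → Fin r → MvPolynomial (Fin n) k)
    (u : Fin c →₀ ℕ) : Module.End (MvPolynomial (Fin n) k) (Taylor k n r) :=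
  if u = 0 then taylorDifferential k m
  else ∑ i : Fin c, if u = Finsupp.single i 1 then taylorHomotopy m (f i) else 0

end Taylor

end TaylorCI

end

/-! Identities. The map `ε_S ↦ m_S e_S` embeds T into the chain complex of the full simplex on [r]
over Q and removes every monomial quotient: τ becomes the sum of the annihilation operators A_s, and
σ_{e_i} becomes ∑_t f_{i,t} m_t C_t with creation operators C_t. The relations A_s C_t + C_t A_s =
δ_{st}, together with the anticommutation and vanishing squares of the A's and of the C's, give τ² =
0, the homotopy formula and the quadratic relations among the σ_{e_i}. As Q is a domain, the
embedding is injective and the identities descend to T (`taylorEmb_differential`,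
`taylorEmb_homotopy`).

Exactness of T (`taylor_exact`). Each C_t contracts the simplex complex. Split a cycle by the
exponents e of its coefficients, and contract the part of exponent e by C_t for one chosen t with
m_t ∣ x^e. The result stays in the image of T: if m_t and m_{S - t} divide x^e, so does m_S.

Exactness of Φ(T). The divided power variables are adjoined one at a time, and all work is done over
Q modulo the submodules N_i = (a_1, …, a_i)F, so that the ring never changes. On M{y} the map d + ts
has square d² + at, hence zero modulo N_1. Given a cycle modulo N_1, its leading coefficient x_n
satisfies d x_n ≡ az modulo N_0; regularity of a makes z a cycle, x_n - sz is then a cycle of the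
original complex modulo N_0, and the exactness already known removes it (`relExact_adjoin`).
Iteration gives `relExact_multiMap`, and reduction modulo N_c turns it into the statement over R. In
degree 0 the cokernel is computed directly from the coefficient of `ε_∅`. -/

noncomputable section

namespace TaylorCI

/-! ### Exactness modulo a chain of submodules under adjunction of divided power variables. -/

section RelativeExactness

variable {Q : Type*} [CommRing Q] {M : Type*} [AddCommGroup M] [Module Q M]

/-- A graded module with a map `d` of degree `-1` and anticommuting maps `s i` of degree `1` that
are homotopies for the `a i`, together with a chain `N` of submodules such that `d` is a
differential modulo `N 0`, each `a i` is regular modulo `N i`, and `N (i + 1) = N i + a i M`. -/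
structure RelComplex (c : ℕ) (ℳ : ℤ → Submodule Q M) (N : ℕ → Submodule Q M) (a : Fin c → Q)
    (d : Module.End Q M) (s : Fin c → Module.End Q M) : Prop where
  bounded : ∀ l < 0, ∀ x ∈ ℳ l, x = 0
  d_deg : ∀ l, ∀ x ∈ ℳ l, d x ∈ ℳ (l - 1)
  s_deg : ∀ i l, ∀ x ∈ ℳ l, s i x ∈ ℳ (l + 1)
  d_mem : ∀ i, ∀ x ∈ N i, d x ∈ N i
  s_mem : ∀ i j, ∀ x ∈ N i, s j x ∈ N i
  d_sq : ∀ x, d (d x) ∈ N 0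
  s_sq : ∀ i x, s i (s i x) = 0
  s_comm : ∀ i j x, s i (s j x) + s j (s i x) = 0
  homotopy : ∀ i x, d (s i x) + s i (d x) = a i • x
  mono : ∀ i : Fin c, ∀ x ∈ N i, x ∈ N (i + 1)
  regular : ∀ (i : Fin c) x, a i • x ∈ N i → x ∈ N i
  smul_mem : ∀ (i : Fin c) x, a i • x ∈ N (i + 1)
  decomp : ∀ (i : Fin c) l, ∀ x ∈ ℳ l, x ∈ N (i + 1) → ∃ z ∈ ℳ l, x - a i • z ∈ N i

/-- Exactness in positive degrees modulo the submodule `N`. -/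
def RelExact (ℳ : ℤ → Submodule Q M) (N : Submodule Q M) (d : Module.End Q M) : Prop :=
  ∀ l > 0, ∀ x ∈ ℳ l, d x ∈ N → ∃ y ∈ ℳ (l + 1), x - d y ∈ N

/-- The finitely supported functions with `x v` in degree `l - 2 |v|`. -/
def shiftGrading {ι : Type*} (w : ι → ℤ) (ℳ : ℤ → Submodule Q M) (l : ℤ) :
    Submodule Q (ι →₀ M) where
  carrier := {x | ∀ v, x v ∈ ℳ (l - 2 * w v)}
  add_mem' hx hy v := by simpa using add_mem (hx v) (hy v)
  zero_mem' v := by simp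
  smul_mem' q x hx v := by simpa using Submodule.smul_mem _ q (hx v)

/-- The finitely supported functions with all values in `N`. -/
def coeffSubmodule (ι : Type*) (N : Submodule Q M) : Submodule Q (ι →₀ M) where
  carrier := {x | ∀ v, x v ∈ N}
  add_mem' hx hy v := by simpa using add_mem (hx v) (hy v)
  zero_mem' v := by simp
  smul_mem' q x hx v := by simpa using Submodule.smul_mem _ q (hx v)

/-- Division by the divided power of exponent `e`. -/
def shiftDown {ι : Type*} [AddCommMonoid ι] [IsRightCancelAdd ι] (e : ι) : Module.End Q (ι →₀ M) :=
  Finsupp.lcomapDomain (fun v => v + e) (add_left_injective e)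

@[simp]
theorem shiftDown_apply {ι : Type*} [AddCommMonoid ι] [IsRightCancelAdd ι] (e : ι) (x : ι →₀ M) (v : ι) :
    shiftDown (Q := Q) e x v = x (v + e) := rfl

/-- The map `d + t s` on `M{y}`. -/
def adjoinMap (d s : Module.End Q M) : Module.End Q (ℕ →₀ M) :=
  Finsupp.mapRange.linearMap d + Finsupp.mapRange.linearMap s ∘ₗ shiftDown 1

@[simp]
theorem adjoinMap_apply (d s : Module.End Q M) (x : ℕ →₀ M) (p : ℕ) :
    adjoinMap d s x p = d (x p) + s (x (p + 1)) := by
  simp [adjoinMap]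

/-- The map `d + ∑ i, t i * s i` on `M{y₁, …, y_c}`. -/
def multiMap {c : ℕ} (d : Module.End Q M) (s : Fin c → Module.End Q M) :
    Module.End Q ((Fin c →₀ ℕ) →₀ M) :=
  Finsupp.mapRange.linearMap d +
    ∑ i, Finsupp.mapRange.linearMap (s i) ∘ₗ shiftDown (Finsupp.single i 1)

@[simp]
theorem multiMap_apply {c : ℕ} (d : Module.End Q M) (s : Fin c → Module.End Q M)
    (x : (Fin c →₀ ℕ) →₀ M) (v : Fin c →₀ ℕ) :
    multiMap d s x v = d (x v) + ∑ i, s i (x (v + Finsupp.single i 1)) := by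
  simp [multiMap, LinearMap.sum_apply]

namespace RelComplex

variable {c : ℕ} {ℳ : ℤ → Submodule Q M} {N : ℕ → Submodule Q M}

/-- The inductive step: the first homotopy is absorbed into the differential and the chain starts
one place later. The other homotopies act coefficientwise and remain homotopies because they
anticommute with `s 0`. -/
theorem adjoin {a : Fin (c + 1) → Q} {d : Module.End Q M} {s : Fin (c + 1) → Module.End Q M}
    (h : RelComplex (c + 1) ℳ N a d s) :
    RelComplex c (shiftGrading (fun p : ℕ => (p : ℤ)) ℳ) (fun i => coeffSubmodule ℕ (N (i + 1)))
      (fun i => a i.succ) (adjoinMap d (s 0))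
      (fun i => Finsupp.mapRange.linearMap (s i.succ)) where
  bounded l hl x hx := by
    ext p
    exact h.bounded _ (by have : (0 : ℤ) ≤ p := by positivity
                          show l - 2 * (p : ℤ) < 0
                          omega) _ (hx p)
  d_deg l x hx p := by
    rw [adjoinMap_apply]
    refine add_mem ?_ ?_
    · have := h.d_deg _ _ (hx p)
      convert this using 2; ring
    · have := h.s_deg 0 _ _ (hx (p + 1))
      convert this using 2; push_cast; ring
  s_deg i l x hx p := by
    have := h.s_deg i.succ _ _ (hx p)
    simp only [Finsupp.mapRange.linearMap_apply, Finsupp.mapRange_apply]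
    convert this using 2; ring
  d_mem i x hx p := by
    rw [adjoinMap_apply]
    exact add_mem (h.d_mem _ _ (hx p)) (h.s_mem _ _ _ (hx (p + 1)))
  s_mem i j x hx p := by
    simpa using h.s_mem _ j.succ _ (hx p)
  d_sq x p := by
    simp only [adjoinMap_apply, map_add]
    have h0 := h.s_sq 0 (x (p + 1 + 1))
    have h1 := h.homotopy 0 (x (p + 1))
    -- (d + ts)² = d² + t(ds + sd) + t²s² = d² + ta.
    have e : d (d (x p)) + d (s 0 (x (p + 1))) + (s 0 (d (x (p + 1))) + s 0 (s 0 (x (p + 1 + 1))))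
        = d (d (x p)) + a 0 • x (p + 1) := by
      rw [h0, ← h1]; abel
    rw [e]
    exact add_mem (by simpa using h.mono 0 _ (h.d_sq _)) (by simpa using h.smul_mem 0 _)
  s_sq i x := by
    ext p; simpa using h.s_sq i.succ (x p)
  s_comm i j x := by
    ext p; simpa using h.s_comm i.succ j.succ (x p)
  homotopy i x := by
    ext p
    have h1 := h.homotopy i.succ (x p)
    have h2 := h.s_comm 0 i.succ (x (p + 1))
    simp only [Finsupp.add_apply, adjoinMap_apply, Finsupp.mapRange.linearMap_apply,
      Finsupp.mapRange_apply, map_add, Finsupp.smul_apply]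
    rw [← h1, add_add_add_comm, h2, add_zero]
  mono i x hx p := by simpa using h.mono i.succ _ (by simpa using hx p)
  regular i x hx p := by simpa using h.regular i.succ _ (by simpa using hx p)
  smul_mem i x p := by simpa using h.smul_mem i.succ _
  decomp i l x hx hN := by
    -- The choice `z = 0` wherever `x p = 0` keeps the family finitely supported.
    have key : ∀ p : ℕ, ∃ z ∈ ℳ (l - 2 * (p : ℤ)), x p - a i.succ • z ∈ N (i + 1) ∧
        (x p = 0 → z = 0) := by
      intro p
      by_cases h0 : x p = 0
      · exact ⟨0, by simp, by simp [h0], fun _ => rfl⟩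
      · obtain ⟨z, hz, hz'⟩ := h.decomp i.succ _ _ (hx p) (by simpa using hN p)
        exact ⟨z, hz, by simpa using hz', fun h => absurd h h0⟩
    choose z hz hz' hz0 using key
    refine ⟨Finsupp.onFinset x.support z fun p hp => ?_, fun p => ?_, fun p => ?_⟩
    · simpa using fun h => hp (hz0 p h)
    · simpa using hz p
    · simpa using hz' p

/-- Adjoining one divided power variable preserves exactness in positive degrees. -/
theorem relExact_adjoin {a : Fin (c + 1) → Q} {d : Module.End Q M}
    {s : Fin (c + 1) → Module.End Q M} (h : RelComplex (c + 1) ℳ N a d s)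
    (hd : RelExact ℳ (N 0) d) :
    RelExact (shiftGrading (fun p : ℕ => (p : ℤ)) ℳ) (coeffSubmodule ℕ (N 1))
      (adjoinMap d (s 0)) := by
  intro l hl
  have hle : ∀ x ∈ N 0, x ∈ N 1 := by simpa using h.mono 0
  -- Descending elimination: `n` bounds the exponents whose coefficients are not yet in `N 1`.
  suffices H : ∀ n : ℕ, ∀ x ∈ shiftGrading (fun p : ℕ => (p : ℤ)) ℳ l,
      adjoinMap d (s 0) x ∈ coeffSubmodule ℕ (N 1) → (∀ p ≥ n, x p ∈ N 1) →
      ∃ y ∈ shiftGrading (fun p : ℕ => (p : ℤ)) ℳ (l + 1),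
        x - adjoinMap d (s 0) y ∈ coeffSubmodule ℕ (N 1) by
    intro x hx hdx
    refine H (x.support.sup id + 1) x hx hdx fun p hp => ?_
    have : x p = 0 := by
      by_contra hp0
      have := Finset.le_sup (f := id) (Finsupp.mem_support_iff.2 hp0)
      simp only [id] at this
      omega
    simp [this]
  intro n
  induction n with
  | zero => exact fun x hx hdx hN => ⟨0, zero_mem _, fun p => by simpa using hN p (Nat.zero_le _)⟩
  | succ n ih =>
    intro x hx hdx hN
    have hDD := h.adjoin.d_sq
    -- Subtracting a boundary keeps the cycle condition, since the square of the new differential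
    -- lies in `N 1`.
    suffices H : ∃ y ∈ shiftGrading (fun p : ℕ => (p : ℤ)) ℳ (l + 1),
        ∀ p ≥ n, (x - adjoinMap d (s 0) y) p ∈ N 1 by
      obtain ⟨y, hy, hyN⟩ := H
      have hdy := h.adjoin.d_deg _ _ hy
      rw [add_sub_cancel_right] at hdy
      obtain ⟨y', hy', hyN'⟩ := ih (x - adjoinMap d (s 0) y) (sub_mem hx hdy)
        (by rw [map_sub]; exact sub_mem hdx (hDD _)) hyN
      exact ⟨y + y', add_mem hy hy', by rw [map_add, ← sub_sub]; exact hyN'⟩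
    have hdn : d (x n) ∈ N 1 := by
      have h1 := hdx n
      rw [adjoinMap_apply] at h1
      exact (Submodule.add_mem_iff_left _ (h.s_mem _ _ _ (hN (n + 1) (by simp)))).1 h1
    rcases lt_trichotomy (l - 2 * (n : ℤ)) 0 with hneg | hzero | hpos
    · refine ⟨0, zero_mem _, fun p hp => ?_⟩
      rcases hp.lt_or_eq with hp | rfl
      · simpa using hN p hp
      · simp [h.bounded _ hneg _ (hx n)]
    -- The leading coefficient has degree 0, where `hd` says nothing. As l > 0 forces n > 0, the
    -- cycle condition one exponent lower is available instead: d x_m + s x_{m+1} ≡ az modulo `N 0`.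
    -- Applying d and cancelling a gives x_{m+1} ≡ dz.
    · obtain ⟨m, rfl⟩ : ∃ m, n = m + 1 := ⟨n - 1, by omega⟩
      have h1 := hdx m
      rw [adjoinMap_apply] at h1
      have hdeg : d (x m) + s 0 (x (m + 1)) ∈ ℳ 1 := by
        refine add_mem ?_ ?_
        · have := h.d_deg _ _ (hx m)
          convert this using 2; push_cast at hzero; linarith
        · have := h.s_deg 0 _ _ (hx (m + 1))
          convert this using 2; linarith
      obtain ⟨z, hz, hzN⟩ := h.decomp 0 _ _ hdeg (by simpa using h1)
      have hdx0 : d (x (m + 1)) = 0 :=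
        h.bounded _ (by rw [hzero]; decide) _ (h.d_deg _ _ (hx (m + 1)))
      have hxz : x (m + 1) - d z ∈ N 0 := by
        apply h.regular 0
        have h2 := h.d_mem _ _ hzN
        have h3 := h.homotopy 0 (x (m + 1))
        rw [hdx0, map_zero, add_zero] at h3
        rw [map_sub, map_add, map_smul, h3] at h2
        have h4 := sub_mem h2 (h.d_sq (x m))
        simp only [Fin.val_zero, smul_sub]
        rwa [add_sub_assoc, add_sub_cancel_left] at h4
      refine ⟨Finsupp.single (m + 1) z, fun p => ?_, fun p hp => ?_⟩
      · rw [Finsupp.single_apply]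
        split_ifs with hp
        · subst hp; convert hz using 2; linarith
        · simp
      · rcases hp.lt_or_eq with hp | rfl
        · simpa [Finsupp.single_apply, hp.ne, (Nat.lt_succ_of_lt hp).ne,
            show m ≠ p by omega] using hN p hp
        · simpa using hle _ hxz
    -- Here d x_n ≡ az modulo `N 0`, and x_n - sz is to be a cycle modulo `N 0`.
    · obtain ⟨z, hz, hzN⟩ := h.decomp 0 _ _ (h.d_deg _ _ (hx n)) (by simpa using hdn)
      have hdz : d z ∈ N 0 := by
        apply h.regular 0
        have h2 := h.d_mem _ _ hzN
        rw [map_sub, map_smul] at h2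
        have h4 := sub_mem (h.d_sq (x n)) h2
        simpa using h4
      have hcyc : d (x n - s 0 z) ∈ N 0 := by
        have h3 := h.homotopy 0 z
        have h5 := h.s_mem 0 0 _ hdz
        have e : d (x n - s 0 z) = (d (x n) - a 0 • z) + s 0 (d z) := by
          rw [map_sub, ← h3]; abel
        rw [e]
        exact add_mem hzN h5
      have hsz := h.s_deg 0 _ _ hz
      rw [sub_add_cancel] at hsz
      obtain ⟨y, hy, hyN⟩ := hd _ hpos _ (sub_mem (hx n) hsz) hcyc
      -- The boundary has coefficient dy + sz at n, which matches x_n, and dz at n + 1, which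
      -- already lies in `N 0`.
      refine ⟨Finsupp.single n y + Finsupp.single (n + 1) z, add_mem (fun p => ?_) fun p => ?_,
        fun p hp => ?_⟩
      · rw [Finsupp.single_apply]
        split_ifs with hp
        · subst hp; convert hy using 2; ring
        · simp
      · rw [Finsupp.single_apply]
        split_ifs with hp
        · subst hp; convert hz using 2; push_cast; ring
        · simp
      · rw [Finsupp.sub_apply, adjoinMap_apply]
        rcases hp.lt_or_eq with hp | rfl
        · refine sub_mem (hN p hp) ?_
          rcases (show n + 1 ≤ p from hp).lt_or_eq with hp' | rfl
          · simp [hp.ne, hp'.ne, show n ≠ p + 1 by omega]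
          · simpa [Finsupp.single_apply, show n ≠ n + 1 + 1 by omega] using hle _ hdz
        · simp only [Finsupp.add_apply, Finsupp.single_eq_same]
          have e1 : (Finsupp.single (n + 1) z : ℕ →₀ M) n = 0 := by simp
          have e2 : (Finsupp.single n y : ℕ →₀ M) (n + 1) = 0 := by simp
          rw [e1, e2, add_zero, zero_add]
          convert hle _ hyN using 1; abel

end RelComplex

/-- Splitting off the first divided power variable. -/
def curryFirst (Q : Type*) [CommRing Q] (M : Type*) [AddCommGroup M] [Module Q M] (c : ℕ) :
    ((Fin (c + 1) →₀ ℕ) →₀ M) ≃ₗ[Q] ((Fin c →₀ ℕ) →₀ (ℕ →₀ M)) :=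
  (Finsupp.domLCongr
    { toFun := fun v => (v.tail, v 0)
      invFun := fun p => Finsupp.cons p.2 p.1
      left_inv := fun v => v.cons_tail
      right_inv := fun p => by simp }).trans (Finsupp.curryLinearEquiv Q)

theorem curryFirst_apply {c : ℕ} (x : (Fin (c + 1) →₀ ℕ) →₀ M) (v : Fin c →₀ ℕ) (p : ℕ) :
    curryFirst Q M c x v p = x (v.cons p) := by
  simp [curryFirst, Finsupp.curryLinearEquiv, Finsupp.domLCongr, Finsupp.equivMapDomain_apply]

theorem cons_add_single_zero {c : ℕ} (v : Fin c →₀ ℕ) (p : ℕ) :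
    v.cons p + Finsupp.single 0 1 = v.cons (p + 1) := by
  ext i; refine Fin.cases ?_ (fun i => ?_) i <;> simp

theorem cons_add_single_succ {c : ℕ} (v : Fin c →₀ ℕ) (p : ℕ) (i : Fin c) :
    v.cons p + Finsupp.single i.succ 1 = (v + Finsupp.single i 1).cons p := by
  ext j; refine Fin.cases ?_ (fun j => ?_) j
  · simp
  · simp [Finsupp.single_apply]

theorem degree_cons {c : ℕ} (v : Fin c →₀ ℕ) (p : ℕ) : (v.cons p).degree = p + v.degree := by
  simp [Finsupp.degree_eq_sum, Fin.sum_univ_succ]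

/-- Compatibility that lets an induction on the number of variables peel off the first one. -/
theorem curryFirst_multiMap {c : ℕ} (d : Module.End Q M) (s : Fin (c + 1) → Module.End Q M)
    (x : (Fin (c + 1) →₀ ℕ) →₀ M) :
    curryFirst Q M c (multiMap d s x) =
      multiMap (adjoinMap d (s 0)) (fun i => Finsupp.mapRange.linearMap (s i.succ))
        (curryFirst Q M c x) := by
  ext v p
  simp [curryFirst_apply, Fin.sum_univ_succ, cons_add_single_zero,
    cons_add_single_succ, add_assoc]

/-- Exactness in positive degrees of the complex obtained by adjoining divided power variables
for all the homotopies. -/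
theorem RelComplex.relExact_multiMap {c : ℕ} : ∀ {M : Type*} [AddCommGroup M] [Module Q M]
    {ℳ : ℤ → Submodule Q M} {N : ℕ → Submodule Q M} {a : Fin c → Q} {d : Module.End Q M}
    {s : Fin c → Module.End Q M}, RelComplex c ℳ N a d s → RelExact ℳ (N 0) d →
    RelExact (shiftGrading (fun v : Fin c →₀ ℕ => (v.degree : ℤ)) ℳ)
      (coeffSubmodule (Fin c →₀ ℕ) (N c)) (multiMap d s) := by
  induction c with
  | zero =>
    intro M _ _ ℳ N a d s h hd l hl x hx hdx
    obtain ⟨y, hy, hyN⟩ := hd l hl (x 0) (by simpa using hx 0) (by simpa using hdx 0)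
    refine ⟨Finsupp.single 0 y, fun v => ?_, fun v => ?_⟩
    · obtain rfl : v = 0 := Subsingleton.elim _ _
      simpa using hy
    · obtain rfl : v = 0 := Subsingleton.elim _ _
      simpa using hyN
  | succ c ih =>
    intro M _ _ ℳ N a d s h hd l hl x hx hdx
    -- The induction hypothesis is used for M{y₁} in place of M, which is why the module and all its
    -- data are quantified after `c`.
    obtain ⟨y, hy, hyN⟩ := ih h.adjoin (h.relExact_adjoin hd) l hl (curryFirst Q M c x)
      (fun v p => by
        rw [curryFirst_apply]
        have := hx (v.cons p)
        beta_reduce at this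
        rw [degree_cons] at this
        convert this using 2; push_cast; ring)
      (fun v p => by
        rw [← curryFirst_multiMap, curryFirst_apply]
        exact hdx _)
    obtain ⟨y, rfl⟩ := (curryFirst Q M c).surjective y
    refine ⟨y, fun v => ?_, fun v => ?_⟩
    · have := hy v.tail (v 0)
      rw [curryFirst_apply, Finsupp.cons_tail] at this
      convert this using 2
      beta_reduce
      conv_lhs => rw [← Finsupp.cons_tail v, degree_cons]
      push_cast; ring
    · have := hyN v.tail (v 0)
      rwa [← curryFirst_multiMap, ← map_sub, curryFirst_apply, Finsupp.cons_tail] at this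

end RelativeExactness

/-! ### Creation and annihilation operators on the simplex. -/

section CreationAnnihilation

variable {r : ℕ} {Q : Type*} [CommRing Q] {A : Type*} [AddCommGroup A] [Module Q A]

/-- The sign of `t` relative to the elements of `S` that are larger than `t`. -/
def sgn (t : Fin r) (S : Finset (Fin r)) : ℤ := (-1) ^ (S.filter fun q => t < q).card

theorem sgn_erase_self (t : Fin r) (S : Finset (Fin r)) : sgn t (S.erase t) = sgn t S := by
  unfold sgn
  congr 2
  ext q; simp only [Finset.mem_filter, Finset.mem_erase]
  exact ⟨fun h => ⟨h.1.2, h.2⟩, fun h => ⟨⟨h.2.ne', h.1⟩, h.2⟩⟩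

theorem sgn_insert_self (t : Fin r) (S : Finset (Fin r)) : sgn t (insert t S) = sgn t S := by
  unfold sgn
  congr 2
  ext q; simp only [Finset.mem_filter, Finset.mem_insert]
  exact ⟨fun h => ⟨h.1.resolve_left h.2.ne', h.2⟩, fun h => ⟨.inr h.1, h.2⟩⟩

theorem sgn_mul_self (t : Fin r) (S : Finset (Fin r)) : sgn t S * sgn t S = 1 := by
  unfold sgn
  rw [← mul_pow]; simp

theorem sgn_insert {s t : Fin r} {S : Finset (Fin r)} (hs : s ∉ S) :
    sgn t (insert s S) = (if t < s then -1 else 1) * sgn t S := by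
  unfold sgn
  rw [Finset.filter_insert]
  split_ifs with h
  · rw [Finset.card_insert_of_notMem (by simp [hs]), pow_succ]; ring
  · simp

theorem sgn_erase {s t : Fin r} {S : Finset (Fin r)} (hs : s ∈ S) :
    sgn t (S.erase s) = (if t < s then -1 else 1) * sgn t S := by
  conv_rhs => rw [← Finset.insert_erase hs, sgn_insert (Finset.notMem_erase s S)]
  split_ifs <;> simp

/-- The annihilation operator `e_S ↦ ± e_{S - t}` for `t ∈ S`. -/
def ann (Q : Type*) [CommRing Q] {A : Type*} [AddCommGroup A] [Module Q A] (t : Fin r) :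
    Module.End Q (Finset (Fin r) → A) where
  toFun x S := if t ∈ S then 0 else sgn t S • x (insert t S)
  map_add' x y := by ext S; simp only [Pi.add_apply]; split_ifs <;> simp
  map_smul' q x := by
    ext S; simp only [Pi.smul_apply, RingHom.id_apply]
    split_ifs
    · simp
    · rw [smul_comm]

/-- The creation operator `e_S ↦ ± e_{S ∪ t}` for `t ∉ S`. -/
def cre (Q : Type*) [CommRing Q] {A : Type*} [AddCommGroup A] [Module Q A] (t : Fin r) :
    Module.End Q (Finset (Fin r) → A) where
  toFun x S := if t ∈ S then sgn t S • x (S.erase t) else 0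
  map_add' x y := by ext S; simp only [Pi.add_apply]; split_ifs <;> simp
  map_smul' q x := by
    ext S; simp only [Pi.smul_apply, RingHom.id_apply]
    split_ifs
    · rw [smul_comm]
    · simp

theorem ann_apply (t : Fin r) (x : Finset (Fin r) → A) (S : Finset (Fin r)) :
    ann Q t x S = if t ∈ S then 0 else sgn t S • x (insert t S) := rfl

theorem cre_apply (t : Fin r) (x : Finset (Fin r) → A) (S : Finset (Fin r)) :
    cre Q t x S = if t ∈ S then sgn t S • x (S.erase t) else 0 := rfl

theorem ann_single (t : Fin r) (S : Finset (Fin r)) (q : A) :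
    ann Q t (Pi.single S q) = if t ∈ S then Pi.single (S.erase t) (sgn t S • q) else 0 := by
  ext U
  rw [ann_apply]
  by_cases hU : t ∈ U
  · rw [if_pos hU]
    split_ifs
    · rw [Pi.single_eq_of_ne]; rintro rfl; simp at hU
    · simp
  · rw [if_neg hU]
    split_ifs with hS
    · by_cases h : U = S.erase t
      · subst h; simp [Finset.insert_erase hS, sgn_erase_self]
      · rw [Pi.single_eq_of_ne h, Pi.single_eq_of_ne, smul_zero]
        rintro rfl; exact h (by simp [Finset.erase_insert hU])
    · rw [Pi.single_eq_of_ne, smul_zero]; rfl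
      rintro rfl; simp at hS

theorem cre_single (t : Fin r) (S : Finset (Fin r)) (q : A) :
    cre Q t (Pi.single S q) = if t ∈ S then 0 else Pi.single (insert t S) (sgn t S • q) := by
  ext U
  rw [cre_apply]
  by_cases hU : t ∈ U
  · rw [if_pos hU]
    split_ifs with hS
    · rw [Pi.single_eq_of_ne, smul_zero]; rfl
      rintro rfl; simp at hS
    · by_cases h : U = insert t S
      · subst h; simp [Finset.erase_insert hS, sgn_insert_self]
      · rw [Pi.single_eq_of_ne h, Pi.single_eq_of_ne, smul_zero]
        rintro rfl; exact h (by simp [Finset.insert_erase hU])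
  · rw [if_neg hU]
    split_ifs
    · simp
    · rw [Pi.single_eq_of_ne]; rintro rfl; simp at hU

/-- For s ≠ t, exactly one of the two orders of removal picks up an extra sign. -/
theorem ann_comm (s t : Fin r) (x : Finset (Fin r) → A) :
    ann Q s (ann Q t x) + ann Q t (ann Q s x) = 0 := by
  ext S
  simp only [Pi.add_apply, ann_apply, Finset.mem_insert, Pi.zero_apply]
  by_cases hs : s ∈ S
  · simp [hs]
  by_cases ht : t ∈ S
  · simp [ht]
  rcases eq_or_ne s t with rfl | hst
  · simp
  simp only [hs, ht, hst, hst.symm, if_false, or_self, smul_smul]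
  rw [Finset.insert_comm s t, sgn_insert hs, sgn_insert ht, ← add_smul]
  rcases hst.lt_or_gt with h | h <;> simp [h, h.not_gt, mul_comm]

theorem cre_comm (s t : Fin r) (x : Finset (Fin r) → A) :
    cre Q s (cre Q t x) + cre Q t (cre Q s x) = 0 := by
  ext S
  simp only [Pi.add_apply, cre_apply, Finset.mem_erase, Pi.zero_apply]
  by_cases hs : s ∈ S
  swap
  · simp [hs]
  by_cases ht : t ∈ S
  swap
  · simp [ht]
  rcases eq_or_ne s t with rfl | hst
  · simp
  simp only [hs, ht, ne_eq, hst, hst.symm, if_true, not_false_eq_true, and_self, smul_smul]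
  rw [Finset.erase_right_comm, sgn_erase hs, sgn_erase ht, ← add_smul]
  rcases hst.lt_or_gt with h | h <;> simp [h, h.not_gt, mul_comm]

theorem cre_cre (t : Fin r) (x : Finset (Fin r) → A) : cre Q t (cre Q t x) = 0 := by
  ext S
  simp [cre_apply]

theorem ann_ann (t : Fin r) (x : Finset (Fin r) → A) : ann Q t (ann Q t x) = 0 := by
  ext S
  simp [ann_apply]

/-- For s = t exactly one summand is nonzero and its two signs cancel; for s ≠ t the two terms
differ by one transposition. -/
theorem ann_cre (s t : Fin r) (x : Finset (Fin r) → A) :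
    ann Q s (cre Q t x) + cre Q t (ann Q s x) = if s = t then x else 0 := by
  ext S
  simp only [Pi.add_apply, ann_apply, cre_apply, Finset.mem_insert, Finset.mem_erase]
  rcases eq_or_ne s t with rfl | hst
  · by_cases hs : s ∈ S
    · simp [hs, smul_smul, sgn_erase_self, sgn_mul_self, Finset.insert_erase]
    · simp [hs, smul_smul, sgn_insert_self, sgn_mul_self]
  · by_cases hs : s ∈ S
    · simp [hs, hst]
    by_cases ht : t ∈ S
    swap
    · simp [ht, hst, hst.symm]
    simp only [hs, ht, hst, if_false, or_true, if_true, and_false, smul_smul, Pi.zero_apply]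
    rw [sgn_insert hs, sgn_erase ht, Finset.erase_insert_of_ne hst, ← add_smul]
    rcases hst.lt_or_gt with h | h <;> simp [h, h.not_gt, mul_comm]

theorem sum_ann_sum_ann (x : Finset (Fin r) → A) : ∑ s, ann Q s (∑ t, ann Q t x) = 0 := by
  simp only [map_sum]
  -- Off-diagonal terms cancel in pairs. The diagonal needs its own hypothesis, as 2 may be a zero
  -- divisor.
  have key : ∀ (ι : Type) [LinearOrder ι] [Fintype ι] (B : Type _) [AddCommGroup B]
      (g : ι → ι → B), (∀ i, g i i = 0) → (∀ i j, g i j + g j i = 0) → ∑ i, ∑ j, g i j = 0 := by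
    intro ι _ _ B _ g h0 h
    rw [← Finset.sum_product']
    refine Finset.sum_involution (fun p _ => (p.2, p.1)) (fun p _ => h _ _) ?_ (by simp) (by simp)
    rintro ⟨i, j⟩ - hne heq
    simp only [Prod.mk.injEq] at heq
    obtain ⟨rfl, -⟩ := heq
    exact hne (h0 _)
  exact key _ _ _ (fun i => ann_ann i x) fun i j => ann_comm i j x

/-- Any single vertex t gives a contracting homotopy: the simplex is a cone with apex t. -/
theorem sum_ann_cre (t : Fin r) (x : Finset (Fin r) → A) :
    ∑ s, ann Q s (cre Q t x) + cre Q t (∑ s, ann Q s x) = x := by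
  rw [map_sum, ← Finset.sum_add_distrib]
  simp [ann_cre]

end CreationAnnihilation

/-! ### The Taylor complex inside the simplex complex: identities and exactness. -/

section TaylorEmbedding

variable {k : Type*} [Field k] {n r : ℕ}

theorem mem_taylorGrading {l : ℤ} {x : Taylor k n r} :
    x ∈ taylorGrading k n r l ↔ ∀ S, x S ≠ 0 → (S.card : ℤ) = l := by
  rw [taylorGrading, Finsupp.mem_supported']
  exact forall_congr' fun S => not_imp_comm

theorem mono_ne_zero (e : Fin n →₀ ℕ) : mono k e ≠ 0 := by
  simp [mono]

theorem mono_mul (e e' : Fin n →₀ ℕ) : mono k e * mono k e' = mono k (e + e') := by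
  simp [mono]

/-- The embedding `ε_S ↦ m_S e_S` of the Taylor complex into the complex of a simplex. -/
def taylorEmb (k : Type*) [Field k] {n r : ℕ} (m : Fin r → Fin n →₀ ℕ) :
    Taylor k n r →ₗ[MvPolynomial (Fin n) k] (Finset (Fin r) → MvPolynomial (Fin n) k) where
  toFun x S := mono k (lcmExp m S) * x S
  map_add' x y := by ext1 S; simp [mul_add]
  map_smul' q x := by ext1 S; simp [mul_left_comm]

theorem taylorEmb_apply (m : Fin r → Fin n →₀ ℕ) (x : Taylor k n r) (S : Finset (Fin r)) :
    taylorEmb k m x S = mono k (lcmExp m S) * x S := rfl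

theorem taylorEmb_apply_ne_zero {m : Fin r → Fin n →₀ ℕ} {x : Taylor k n r}
    {S : Finset (Fin r)} : taylorEmb k m x S ≠ 0 ↔ x S ≠ 0 := by
  simp [taylorEmb_apply, mono_ne_zero]

theorem taylorEmb_injective (m : Fin r → Fin n →₀ ℕ) : Function.Injective (taylorEmb k m) := by
  intro x y h
  ext1 S
  exact mul_left_cancel₀ (mono_ne_zero _) (congr_fun h S)

theorem taylorEmb_single (m : Fin r → Fin n →₀ ℕ) (S : Finset (Fin r))
    (q : MvPolynomial (Fin n) k) :
    taylorEmb k m (Finsupp.single S q) = Pi.single S (mono k (lcmExp m S) * q) := by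
  ext1 U
  rw [taylorEmb_apply]
  rcases eq_or_ne U S with rfl | h
  · simp
  · simp [h]

theorem sgn_smul (t : Fin r) (S : Finset (Fin r)) (q : MvPolynomial (Fin n) k) :
    sgn t S • q = (-1) ^ (S.filter fun q => t < q).card * q := by
  simp [sgn, zsmul_eq_mul]

/-- The quotient m_S / m_{S - s} is exactly what rescaling the basis by m_S absorbs. -/
theorem taylorEmb_differential (m : Fin r → Fin n →₀ ℕ) (x : Taylor k n r) :
    taylorEmb k m (taylorDifferential k m x) =
      ∑ t, ann (MvPolynomial (Fin n) k) t (taylorEmb k m x) := by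
  induction x using Finsupp.induction_linear with
  | zero => simp
  | add x y hx hy => simp only [map_add, hx, hy, Finset.sum_add_distrib]
  | single S q =>
    rw [taylorDifferential, Finsupp.linearCombination_single, map_smul, map_sum]
    simp only [taylorEmb_single, ann_single, Finset.sum_ite_mem, Finset.univ_inter]
    rw [Finset.smul_sum]
    refine Finset.sum_congr rfl fun s hs => ?_
    rw [← Pi.single_smul, smul_eq_mul, sgn_smul]
    congr 1
    have h : lcmExp m (S.erase s) ≤ lcmExp m S := Finset.sup_mono (Finset.erase_subset s S)
    rw [mul_left_comm (mono k _), mono_mul, add_tsub_cancel_of_le h]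
    ring

theorem taylorEmb_homotopy (m : Fin r → Fin n →₀ ℕ) (f : Fin r → MvPolynomial (Fin n) k)
    (x : Taylor k n r) :
    taylorEmb k m (taylorHomotopy m f x) =
      ∑ t, (f t * mono k (m t)) • cre (MvPolynomial (Fin n) k) t (taylorEmb k m x) := by
  induction x using Finsupp.induction_linear with
  | zero => simp
  | add x y hx hy => simp only [map_add, hx, hy, smul_add, Finset.sum_add_distrib]
  | single S q =>
    rw [taylorHomotopy, Finsupp.linearCombination_single, map_smul, map_sum]
    simp only [taylorEmb_single, cre_single]
    rw [Finset.smul_sum, ← Finset.sum_subset (Finset.subset_univ Sᶜ)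
      (fun t _ ht => by simp [not_not.1 (mt Finset.mem_compl.2 ht)])]
    refine Finset.sum_congr rfl fun t ht => ?_
    rw [if_neg (Finset.mem_compl.1 ht), ← Pi.single_smul, ← Pi.single_smul, smul_eq_mul,
      smul_eq_mul, sgn_smul]
    congr 1
    have h : lcmExp m (insert t S) ≤ m t + lcmExp m S := by
      rw [lcmExp, Finset.sup_insert]
      exact sup_le le_self_add le_add_self
    have e : mono k (lcmExp m (insert t S)) *
        mono k (m t + lcmExp m S - lcmExp m (insert t S)) =
        mono k (m t) * mono k (lcmExp m S) := by
      rw [mono_mul, add_tsub_cancel_of_le h, mono_mul]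
    linear_combination (q * (-1) ^ (S.filter fun q => t < q).card * f t) * e

theorem taylorDifferential_sq (m : Fin r → Fin n →₀ ℕ) (x : Taylor k n r) :
    taylorDifferential k m (taylorDifferential k m x) = 0 := by
  apply taylorEmb_injective m
  rw [taylorEmb_differential, taylorEmb_differential, sum_ann_sum_ann, map_zero]

theorem taylorHomotopy_homotopy (m : Fin r → Fin n →₀ ℕ) (f : Fin r → MvPolynomial (Fin n) k)
    (x : Taylor k n r) :
    taylorDifferential k m (taylorHomotopy m f x) + taylorHomotopy m f (taylorDifferential k m x)
      = (∑ t, f t * mono k (m t)) • x := by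
  apply taylorEmb_injective m
  rw [map_add, taylorEmb_differential, taylorEmb_homotopy, taylorEmb_homotopy,
    taylorEmb_differential, map_smul, Finset.sum_smul]
  simp only [map_sum, map_smul]
  rw [Finset.sum_comm, ← Finset.sum_add_distrib]
  refine Finset.sum_congr rfl fun t _ => ?_
  rw [← Finset.smul_sum, ← smul_add, ← map_sum, sum_ann_cre]

theorem taylorHomotopy_comm (m : Fin r → Fin n →₀ ℕ) (f g : Fin r → MvPolynomial (Fin n) k)
    (x : Taylor k n r) :
    taylorHomotopy m f (taylorHomotopy m g x) + taylorHomotopy m g (taylorHomotopy m f x) = 0 := by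
  apply taylorEmb_injective m
  rw [map_add]
  simp only [taylorEmb_homotopy, map_sum, map_smul, map_zero, Finset.smul_sum]
  conv_lhs => arg 2; rw [Finset.sum_comm]
  simp only [← Finset.sum_add_distrib]
  refine Finset.sum_eq_zero fun s _ => Finset.sum_eq_zero fun t _ => ?_
  rw [smul_comm (g t * _), ← smul_add, ← smul_add, cre_comm, smul_zero, smul_zero]

/-- Not a consequence of `taylorHomotopy_comm` in characteristic 2, so the diagonal terms are killed
by `cre_cre`. -/
theorem taylorHomotopy_sq (m : Fin r → Fin n →₀ ℕ) (f : Fin r → MvPolynomial (Fin n) k)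
    (x : Taylor k n r) : taylorHomotopy m f (taylorHomotopy m f x) = 0 := by
  apply taylorEmb_injective m
  simp only [taylorEmb_homotopy, map_sum, map_smul, map_zero, Finset.smul_sum]
  rw [← Finset.sum_product']
  refine Finset.sum_involution (fun p _ => (p.2, p.1)) (fun p _ => ?_) ?_ (by simp) (by simp)
  · rw [smul_comm (f p.2 * _), ← smul_add, ← smul_add, cre_comm, smul_zero, smul_zero]
  · rintro ⟨i, j⟩ - hne heq
    simp only [Prod.mk.injEq] at heq
    obtain ⟨rfl, -⟩ := heq
    exact hne (by simp [cre_cre])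

theorem taylorDifferential_mem (m : Fin r → Fin n →₀ ℕ) {l : ℤ} {x : Taylor k n r}
    (hx : x ∈ taylorGrading k n r l) : taylorDifferential k m x ∈ taylorGrading k n r (l - 1) := by
  rw [mem_taylorGrading] at hx ⊢
  intro S hS
  rw [← taylorEmb_apply_ne_zero (m := m), taylorEmb_differential, Finset.sum_apply] at hS
  obtain ⟨t, -, ht⟩ := Finset.exists_ne_zero_of_sum_ne_zero hS
  rw [ann_apply] at ht
  have htS : t ∉ S := fun h => ht (if_pos h)
  rw [if_neg htS] at ht
  have := hx _ (taylorEmb_apply_ne_zero.1 (right_ne_zero_of_smul ht))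
  rw [Finset.card_insert_of_notMem htS] at this
  push_cast at this
  linarith

theorem card_eq_of_cre_ne_zero {A : Type*} [AddCommGroup A] [Module (MvPolynomial (Fin n) k) A]
    {l : ℤ} {t : Fin r} {x : Finset (Fin r) → A} (hx : ∀ S, x S ≠ 0 → (S.card : ℤ) = l)
    {S : Finset (Fin r)} (h : cre (MvPolynomial (Fin n) k) t x S ≠ 0) : (S.card : ℤ) = l + 1 := by
  rw [cre_apply] at h
  have htS : t ∈ S := by by_contra hS; exact h (if_neg hS)
  rw [if_pos htS] at h
  have := hx _ (right_ne_zero_of_smul h)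
  rw [← this]
  exact_mod_cast (Finset.card_erase_add_one htS).symm

theorem taylorHomotopy_mem (m : Fin r → Fin n →₀ ℕ) (f : Fin r → MvPolynomial (Fin n) k) {l : ℤ}
    {x : Taylor k n r} (hx : x ∈ taylorGrading k n r l) :
    taylorHomotopy m f x ∈ taylorGrading k n r (l + 1) := by
  rw [mem_taylorGrading] at hx ⊢
  intro S hS
  rw [← taylorEmb_apply_ne_zero (m := m), taylorEmb_homotopy, Finset.sum_apply] at hS
  obtain ⟨t, -, ht⟩ := Finset.exists_ne_zero_of_sum_ne_zero hS
  rw [Pi.smul_apply] at ht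
  exact card_eq_of_cre_ne_zero (fun S hS => hx S (taylorEmb_apply_ne_zero.1 hS))
    (right_ne_zero_of_smul ht)

/-- The part of a polynomial supported on the exponents satisfying `p`. -/
def restrictExp (k : Type*) [Field k] {n : ℕ} (p : (Fin n →₀ ℕ) → Prop) [DecidablePred p] :
    MvPolynomial (Fin n) k →+ MvPolynomial (Fin n) k where
  toFun q := ∑ e ∈ q.support.filter p, MvPolynomial.monomial e (q.coeff e)
  map_zero' := by simp
  map_add' x y := by
    have key : ∀ (q : MvPolynomial (Fin n) k) e, MvPolynomial.coeff e
        (∑ e ∈ q.support.filter p, MvPolynomial.monomial e (q.coeff e)) =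
        if p e then q.coeff e else 0 := by
      intro q e
      simp only [MvPolynomial.coeff_sum, MvPolynomial.coeff_monomial, Finset.sum_ite_eq',
        Finset.mem_filter, MvPolynomial.mem_support_iff]
      split_ifs <;> simp_all
    ext e
    rw [MvPolynomial.coeff_add, key, key, key]
    split_ifs <;> simp

theorem coeff_restrictExp (p : (Fin n →₀ ℕ) → Prop) [DecidablePred p]
    (q : MvPolynomial (Fin n) k) (e : Fin n →₀ ℕ) :
    (restrictExp k p q).coeff e = if p e then q.coeff e else 0 := by
  simp only [restrictExp, AddMonoidHom.coe_mk, ZeroHom.coe_mk, MvPolynomial.coeff_sum,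
    MvPolynomial.coeff_monomial, Finset.sum_ite_eq', Finset.mem_filter,
    MvPolynomial.mem_support_iff]
  split_ifs <;> simp_all

/-- The operator has coefficients 0 and ±1, so additivity of `g` suffices; this matters for
`restrictExp`, which is not Q-linear. -/
theorem ann_comp {A : Type*} [AddCommGroup A] {Q : Type*} [CommRing Q] [Module Q A] (g : A →+ A)
    (t : Fin r) (x : Finset (Fin r) → A) :
    ann Q t (fun S => g (x S)) = fun S => g (ann Q t x S) := by
  ext S
  simp only [ann_apply]
  split_ifs <;> simp

theorem mono_dvd_iff {e : Fin n →₀ ℕ} {q : MvPolynomial (Fin n) k} :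
    mono k e ∣ q ↔ ∀ e', q.coeff e' ≠ 0 → e ≤ e' := by
  have := MvPolynomial.mem_ideal_span_monomial_image (R := k) (x := q) (s := {e})
  rw [Set.image_singleton, Ideal.mem_span_singleton] at this
  simpa [mono] using this

open Classical in
/-- The Taylor complex is exact in positive degrees. -/
theorem taylor_exact (m : Fin r → Fin n →₀ ℕ) {l : ℤ} (hl : 0 < l) {x : Taylor k n r}
    (hx : x ∈ taylorGrading k n r l) (hdx : taylorDifferential k m x = 0) :
    ∃ y ∈ taylorGrading k n r (l + 1), taylorDifferential k m y = x := by
  -- `P e t` says that t is the index chosen for e. The choice depends on e alone and not on S, so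
  -- restricting to `P · t` commutes with the differential.
  let P : (Fin n →₀ ℕ) → Fin r → Prop := fun e t =>
    ∃ h : ∃ t, m t ≤ e, h.choose = t
  have hP : ∀ {e t}, P e t → m t ≤ e := by
    rintro e t ⟨h, rfl⟩; exact h.choose_spec
  let X := taylorEmb k m x
  let Y : Finset (Fin r) → MvPolynomial (Fin n) k :=
    ∑ t, cre (MvPolynomial (Fin n) k) t (fun S => restrictExp k (fun e => P e t) (X S))
  have hX : ∑ t, ann (MvPolynomial (Fin n) k) t X = 0 := by
    rw [← taylorEmb_differential, hdx, map_zero]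
  have hY : ∑ s, ann (MvPolynomial (Fin n) k) s Y = X := by
    have h1 : ∀ t, ∑ s, ann (MvPolynomial (Fin n) k) s (cre (MvPolynomial (Fin n) k) t
        (fun S => restrictExp k (fun e => P e t) (X S))) =
        fun S => restrictExp k (fun e => P e t) (X S) := by
      intro t
      have h2 := sum_ann_cre (Q := MvPolynomial (Fin n) k) t
        (fun S => restrictExp k (fun e => P e t) (X S))
      have h3 : ∑ s, ann (MvPolynomial (Fin n) k) s
          (fun S => restrictExp k (fun e => P e t) (X S)) = 0 := by
        ext1 S
        simp only [ann_comp, Finset.sum_apply, ← map_sum]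
        have := congr_fun hX S
        rw [Finset.sum_apply] at this
        rw [this]; simp
      rwa [h3, map_zero, add_zero] at h2
    simp only [Y, map_sum]
    rw [Finset.sum_comm]
    simp only [h1]
    ext S e
    simp only [Finset.sum_apply, MvPolynomial.coeff_sum, coeff_restrictExp]
    by_cases h0 : (X S).coeff e = 0
    · simp [h0]
    -- The only use of `0 < l`: a member of S supplies some m_t dividing x^e.
    have hS : S.Nonempty := by
      rw [← Finset.card_pos]
      have : x S ≠ 0 := taylorEmb_apply_ne_zero.1 (fun h => h0 (by
        show MvPolynomial.coeff e (taylorEmb k m x S) = 0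
        rw [h]; simp))
      have := mem_taylorGrading.1 hx S this
      omega
    obtain ⟨s, hs⟩ := hS
    have he : lcmExp m S ≤ e :=
      mono_dvd_iff.1 (Dvd.intro _ rfl : mono k (lcmExp m S) ∣ X S) e h0
    have hex : ∃ t, m t ≤ e := ⟨s, (Finset.le_sup (f := m) hs).trans he⟩
    rw [Finset.sum_eq_single hex.choose]
    · exact if_pos ⟨hex, rfl⟩
    · rintro t - ht
      exact if_neg fun ⟨_, h⟩ => ht h.symm
    · simp
  -- This divisibility places the contraction in the image of the Taylor complex.
  have hdvd : ∀ S, mono k (lcmExp m S) ∣ Y S := by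
    intro S
    simp only [Y, Finset.sum_apply]
    refine Finset.dvd_sum fun t _ => ?_
    rw [cre_apply]
    split_ifs with ht
    swap
    · simp
    rw [sgn_smul]
    refine Dvd.dvd.mul_left (mono_dvd_iff.2 fun e he => ?_) _
    rw [coeff_restrictExp] at he
    have hPe : P e t := by by_contra h; exact he (if_neg h)
    rw [if_pos hPe] at he
    have h1 : lcmExp m (S.erase t) ≤ e :=
      mono_dvd_iff.1 (Dvd.intro _ rfl : mono k (lcmExp m (S.erase t)) ∣ X (S.erase t)) e he
    rw [lcmExp, ← Finset.insert_erase ht, Finset.sup_insert]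
    exact sup_le (hP hPe) h1
  choose y hy using hdvd
  have hyY : taylorEmb k m (Finsupp.equivFunOnFinite.symm y) = Y := by
    ext1 S
    rw [taylorEmb_apply, hy]; rfl
  refine ⟨Finsupp.equivFunOnFinite.symm y, ?_, taylorEmb_injective m ?_⟩
  · rw [mem_taylorGrading]
    intro S hS
    rw [← taylorEmb_apply_ne_zero (m := m), hyY] at hS
    simp only [Y, Finset.sum_apply] at hS
    obtain ⟨t, -, ht⟩ := Finset.exists_ne_zero_of_sum_ne_zero hS
    refine card_eq_of_cre_ne_zero (fun S hS => ?_) ht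
    refine mem_taylorGrading.1 hx S (taylorEmb_apply_ne_zero (m := m).1 fun h => hS ?_)
    show restrictExp k _ (taylorEmb k m x S) = 0
    rw [h, map_zero]
  · rw [taylorEmb_differential, hyY, hY]

end TaylorEmbedding

/-! ### Gradings defined by a weight on a basis. -/

section GradedByBasis

variable {R M ι : Type*} [CommRing R] [AddCommGroup M] [Module R M]

theorem isInternal_span_basis (b : Module.Basis ι R M) (w : ι → ℤ) :
    DirectSum.IsInternal fun l => Submodule.span R (b '' {i | w i = l}) := by
  apply DirectSum.isInternal_submodule_of_iSupIndep_of_iSup_eq_top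
  · intro l
    refine (b.linearIndependent.disjoint_span_image (s := {i | w i = l}) (t := {i | w i ≠ l})
      (Set.disjoint_left.2 fun i h h' => h' h)).mono_right ?_
    refine iSup₂_le fun j hj => Submodule.span_mono (Set.image_mono ?_)
    rintro i rfl
    exact hj
  · rw [eq_top_iff, ← b.span_eq, Submodule.span_le]
    rintro _ ⟨i, rfl⟩
    exact Submodule.mem_iSup_of_mem (w i) (Submodule.subset_span ⟨i, rfl, rfl⟩)

theorem free_span_basis (b : Module.Basis ι R M) (s : Set ι) :
    Module.Free R (Submodule.span R (b '' s)) := by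
  rw [Set.image_eq_range]
  exact Module.Free.of_basis
    (Module.Basis.span (b.linearIndependent.comp (Subtype.val : s → ι) Subtype.val_injective))

end GradedByBasis

/-! ### The total map with all variables adjoined. -/

section MultiMap

variable {Q : Type*} [CommRing Q] {M : Type*} [AddCommGroup M] [Module Q M]

theorem RelComplex.multiMap_sq {c : ℕ} : ∀ {M : Type*} [AddCommGroup M] [Module Q M]
    {ℳ : ℤ → Submodule Q M} {N : ℕ → Submodule Q M} {a : Fin c → Q} {d : Module.End Q M}
    {s : Fin c → Module.End Q M}, RelComplex c ℳ N a d s →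
    ∀ x, multiMap d s (multiMap d s x) ∈ coeffSubmodule (Fin c →₀ ℕ) (N c) := by
  induction c with
  | zero =>
    intro M _ _ ℳ N a d s h x v
    simpa using h.d_sq (x v)
  | succ c ih =>
    intro M _ _ ℳ N a d s h x v
    have := ih h.adjoin (curryFirst Q M c x) v.tail (v 0)
    rwa [← curryFirst_multiMap, ← curryFirst_multiMap, curryFirst_apply, Finsupp.cons_tail] at this

theorem RelComplex.multiMap_mem {c : ℕ} {ℳ : ℤ → Submodule Q M} {N : ℕ → Submodule Q M}
    {a : Fin c → Q} {d : Module.End Q M} {s : Fin c → Module.End Q M}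
    (h : RelComplex c ℳ N a d s) {l : ℤ} {x : (Fin c →₀ ℕ) →₀ M}
    (hx : x ∈ shiftGrading (fun v : Fin c →₀ ℕ => (v.degree : ℤ)) ℳ l) :
    multiMap d s x ∈ shiftGrading (fun v : Fin c →₀ ℕ => (v.degree : ℤ)) ℳ (l - 1) := by
  intro v
  rw [multiMap_apply]
  refine add_mem ?_ (sum_mem fun i _ => ?_)
  · convert h.d_deg _ _ (hx v) using 2; ring
  · convert h.s_deg i _ _ (hx (v + Finsupp.single i 1)) using 2
    simp only [map_add, Finsupp.degree_single]
    push_cast; ring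

theorem multiMap_single_zero {c : ℕ} (d : Module.End Q M) (s : Fin c → Module.End Q M) (y : M) :
    multiMap d s (Finsupp.single 0 y) = Finsupp.single 0 (d y) := by
  ext v
  have h : ∀ i : Fin c, v + Finsupp.single i 1 ≠ 0 := by
    intro i hi
    have := DFunLike.congr_fun hi i
    simp at this
  rw [multiMap_apply, Finset.sum_eq_zero fun i _ => by
    rw [Finsupp.single_eq_of_ne (h i), map_zero], add_zero]
  rcases eq_or_ne v 0 with rfl | hv
  · simp
  · simp [hv]

/-- The submodule is JF for the free module F, and every linear map preserves JF. -/
theorem map_mem_coeffSubmodule {ι : Type*} {J : Ideal Q} (T : Module.End Q (ι →₀ Q))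
    {x : ι →₀ Q} (hx : x ∈ coeffSubmodule ι J) : T x ∈ coeffSubmodule ι J := by
  intro j
  rw [← Finsupp.sum_single x, Finsupp.sum, map_sum, Finsupp.finsetSum_apply]
  refine sum_mem fun i _ => ?_
  rw [← mul_one (x i), ← smul_eq_mul, ← Finsupp.smul_single, map_smul, Finsupp.smul_apply,
    smul_eq_mul]
  exact J.mul_mem_right _ (hx i)

end MultiMap

/-! ### The ideals generated by initial segments of the sequence. -/

section InitialIdeals

variable {Q : Type*} [CommRing Q] {c : ℕ}

/-- The ideal generated by the first `i` of the elements `a`. -/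
def initialIdeal (a : Fin c → Q) (i : ℕ) : Ideal Q := Ideal.span (a '' {j | (j : ℕ) < i})

theorem initialIdeal_zero (a : Fin c → Q) : initialIdeal a 0 = ⊥ := by
  simp [initialIdeal]

theorem initialIdeal_last (a : Fin c → Q) : initialIdeal a c = Ideal.span (Set.range a) := by
  simp [initialIdeal]

theorem initialIdeal_mono (a : Fin c → Q) (i : ℕ) : initialIdeal a i ≤ initialIdeal a (i + 1) :=
  Ideal.span_mono (Set.image_mono fun _ hj => Nat.lt_succ_of_lt hj)

theorem mem_initialIdeal_succ (a : Fin c → Q) (i : Fin c) : a i ∈ initialIdeal a (i + 1) :=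
  Ideal.subset_span ⟨i, Nat.lt_succ_self _, rfl⟩

theorem exists_sub_mem_initialIdeal (a : Fin c → Q) (i : Fin c) {q : Q}
    (hq : q ∈ initialIdeal a (i + 1)) : ∃ z, q - a i * z ∈ initialIdeal a i := by
  have h : initialIdeal a (i + 1) ≤ Ideal.span (insert (a i) (a '' {j | (j : ℕ) < i})) := by
    refine Ideal.span_mono ?_
    rintro _ ⟨j, hj, rfl⟩
    rcases (Nat.lt_succ_iff.1 hj).lt_or_eq with h | h
    · exact .inr ⟨j, h, rfl⟩
    · exact .inl (by rw [Fin.ext h])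
  obtain ⟨z, y, hy, rfl⟩ := Ideal.mem_span_insert.1 (h hq)
  refine ⟨z, ?_⟩
  rw [mul_comm (a i), add_sub_cancel_left]
  exact hy

theorem mem_initialIdeal_of_mul_mem {a : Fin c → Q}
    (ha : RingTheory.Sequence.IsWeaklyRegular Q (List.ofFn a)) (i : Fin c) {q : Q}
    (hq : a i * q ∈ initialIdeal a i) : q ∈ initialIdeal a i := by
  have h := ha.regular_mod_prev i (by simp)
  have e : (Ideal.ofList ((List.ofFn a).take i) • ⊤ : Submodule Q Q) = initialIdeal a i := by
    rw [smul_eq_mul, Ideal.mul_top, Ideal.ofList, initialIdeal]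
    congr 1
    ext y
    simp only [Set.mem_ofPred_eq, List.mem_take_iff_getElem, Set.mem_image]
    constructor
    · rintro ⟨j, hj, rfl⟩
      simp only [List.length_ofFn, lt_inf_iff] at hj
      exact ⟨⟨j, hj.2⟩, hj.1, by simp⟩
    · rintro ⟨j, hj, rfl⟩
      exact ⟨j, by simpa using hj, by simp⟩
  rw [e, List.getElem_ofFn] at h
  rw [← Ideal.Quotient.eq_zero_iff_mem] at hq ⊢
  apply h
  simp only [smul_zero]
  exact hq

end InitialIdeals

/-! ### The Taylor complex as a relative complex, and its system of higher homotopies. -/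

section TaylorRelComplex

variable {k : Type*} [Field k] {n r c : ℕ}

theorem taylor_relComplex (m : Fin r → Fin n →₀ ℕ) (a : Fin c → MvPolynomial (Fin n) k)
    (ha : RingTheory.Sequence.IsWeaklyRegular (MvPolynomial (Fin n) k) (List.ofFn a))
    (f : Fin c → Fin r → MvPolynomial (Fin n) k)
    (haf : ∀ i, a i = ∑ j, f i j * mono k (m j)) :
    RelComplex c (taylorGrading k n r)
      (fun i => coeffSubmodule (Finset (Fin r)) (initialIdeal a i)) a
      (taylorDifferential k m) (fun i => taylorHomotopy m (f i)) where
  bounded l hl x hx := by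
    ext1 S
    by_contra h
    have := mem_taylorGrading.1 hx S h
    omega
  d_deg l x hx := taylorDifferential_mem m hx
  s_deg i l x hx := taylorHomotopy_mem m (f i) hx
  d_mem i x hx := map_mem_coeffSubmodule _ hx
  s_mem i j x hx := map_mem_coeffSubmodule _ hx
  d_sq x := by rw [taylorDifferential_sq]; exact zero_mem _
  s_sq i x := taylorHomotopy_sq m _ x
  s_comm i j x := taylorHomotopy_comm m _ _ x
  homotopy i x := by rw [taylorHomotopy_homotopy, haf]
  mono i x hx S := initialIdeal_mono a i (hx S)
  regular i x hx S := mem_initialIdeal_of_mul_mem ha i (hx S)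
  smul_mem i x S := Ideal.mul_mem_right _ _ (mem_initialIdeal_succ a i)
  decomp i l x hx hN := by
    choose z hz using fun S => exists_sub_mem_initialIdeal a i (hN S)
    classical
    -- Zero outside the support of x, so that homogeneity is preserved.
    refine ⟨Finsupp.equivFunOnFinite.symm fun S => if x S = 0 then 0 else z S, ?_, fun S => ?_⟩
    · rw [mem_taylorGrading] at hx ⊢
      intro S hS
      refine hx S fun h => hS ?_
      simp [h]
    · by_cases h : x S = 0
      · simp [h]
      · simpa [h] using hz S

theorem taylor_relExact (m : Fin r → Fin n →₀ ℕ) (a : Fin c → MvPolynomial (Fin n) k) :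
    RelExact (taylorGrading k n r) (coeffSubmodule (Finset (Fin r)) (initialIdeal a 0))
      (taylorDifferential k m) := by
  intro l hl x hx hdx
  have h0 : taylorDifferential k m x = 0 := by
    ext1 S
    simpa [initialIdeal_zero] using hdx S
  obtain ⟨y, hy, hyx⟩ := taylor_exact m hl hx h0
  exact ⟨y, hy, by rw [hyx, sub_self]; exact zero_mem _⟩

theorem taylorGrading_eq_span (l : ℤ) :
    taylorGrading k n r l = Submodule.span (MvPolynomial (Fin n) k)
      ((Finsupp.basisSingleOne : Module.Basis (Finset (Fin r)) (MvPolynomial (Fin n) k) _) ''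
        {S | (S.card : ℤ) = l}) := by
  rw [taylorGrading, Finsupp.supported_eq_span_single]
  simp

theorem taylor_isFreeComplex (m : Fin r → Fin n →₀ ℕ) :
    IsFreeComplex (taylorGrading k n r) (taylorDifferential k m) where
  internal := by
    rw [funext (taylorGrading_eq_span (k := k) (n := n) (r := r))]
    exact isInternal_span_basis _ _
  free l := by
    rw [taylorGrading_eq_span]
    exact free_span_basis _ _
  degree l x hx := taylorDifferential_mem m hx
  sq_zero := LinearMap.ext fun x => taylorDifferential_sq m x

/-- A form without case distinction, suited to summing over all u. -/
theorem taylorSystem_eq (m : Fin r → Fin n →₀ ℕ) (f : Fin c → Fin r → MvPolynomial (Fin n) k)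
    (u : Fin c →₀ ℕ) :
    taylorSystem m f u = (if u = 0 then taylorDifferential k m else 0) +
      ∑ i, if u = Finsupp.single i 1 then taylorHomotopy m (f i) else 0 := by
  unfold taylorSystem
  split_ifs with h
  · subst h
    rw [Finset.sum_eq_zero, add_zero]
    intro i _
    rw [if_neg]
    simp [eq_comm]
  · rw [zero_add]

theorem taylorSystem_zero (m : Fin r → Fin n →₀ ℕ) (f : Fin c → Fin r → MvPolynomial (Fin n) k) :
    taylorSystem m f 0 = taylorDifferential k m := if_pos rfl

theorem taylorSystem_single (m : Fin r → Fin n →₀ ℕ) (f : Fin c → Fin r → MvPolynomial (Fin n) k)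
    (i : Fin c) : taylorSystem m f (Finsupp.single i 1) = taylorHomotopy m (f i) := by
  rw [taylorSystem, if_neg (by simp), Finset.sum_eq_single i, if_pos rfl]
  · intro j _ hj
    rw [if_neg]
    rw [Finsupp.single_left_inj one_ne_zero]
    exact hj.symm
  · simp

theorem exists_eq_single_of_degree_eq_one {u : Fin c →₀ ℕ} (hu : u.degree = 1) :
    ∃ i, u = Finsupp.single i 1 := by
  have h0 : u ≠ 0 := by rintro rfl; simp at hu
  obtain ⟨i, hi⟩ := Finsupp.ne_iff.1 h0
  refine ⟨i, ?_⟩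
  have hle : Finsupp.single i 1 ≤ u := by
    rw [Finsupp.single_le_iff]
    exact Nat.one_le_iff_ne_zero.2 hi
  obtain ⟨v, rfl⟩ := exists_add_of_le hle
  rw [map_add, Finsupp.degree_single, Nat.add_eq_left, Finsupp.degree_eq_zero_iff] at hu
  rw [hu, add_zero]

theorem taylorSystem_eq_zero (m : Fin r → Fin n →₀ ℕ)
    (f : Fin c → Fin r → MvPolynomial (Fin n) k) {u : Fin c →₀ ℕ} (hu : 2 ≤ u.degree) :
    taylorSystem m f u = 0 := by
  rw [taylorSystem, if_neg (by rintro rfl; simp at hu)]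
  refine Finset.sum_eq_zero fun i _ => if_neg ?_
  rintro rfl
  simp at hu

theorem sum_antidiagonal_eq_zero {ι A : Type*} [AddCommMonoid ι] [Finset.HasAntidiagonal ι]
    [AddCommMonoid A] (u : ι) (g : ι × ι → A)
    (h : ∀ b ∈ Finset.HasAntidiagonal.antidiagonal u, g b + g b.swap = 0)
    (h0 : ∀ b ∈ Finset.HasAntidiagonal.antidiagonal u, b.1 = b.2 → g b = 0) :
    ∑ b ∈ Finset.HasAntidiagonal.antidiagonal u, g b = 0 := by
  refine Finset.sum_involution (fun p _ => p.swap) h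
    (fun b hb hne heq => hne (h0 b hb (congr_arg Prod.snd heq))) (fun b hb => ?_)
    (fun b _ => Prod.swap_swap b)
  rw [Finset.HasAntidiagonal.mem_antidiagonal] at hb ⊢
  rw [← hb, add_comm]
  rfl

theorem taylor_isSystemOfHigherHomotopies (m : Fin r → Fin n →₀ ℕ)
    (a : Fin c → MvPolynomial (Fin n) k) (f : Fin c → Fin r → MvPolynomial (Fin n) k)
    (haf : ∀ i, a i = ∑ j, f i j * mono k (m j)) :
    IsSystemOfHigherHomotopies a (taylorGrading k n r) (taylorDifferential k m)
      (taylorSystem m f) where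
  isFreeComplex := taylor_isFreeComplex m
  degree u l x hx := by
    rcases lt_or_ge u.degree 2 with h | h
    · interval_cases hu : u.degree
      · rw [Finsupp.degree_eq_zero_iff] at hu
        subst hu
        rw [taylorSystem_zero]
        exact taylorDifferential_mem m hx
      · obtain ⟨i, rfl⟩ := exists_eq_single_of_degree_eq_one hu
        rw [taylorSystem_single]
        exact taylorHomotopy_mem m _ hx
    · rw [taylorSystem_eq_zero m f h]
      exact zero_mem _
  zero := taylorSystem_zero m f
  single j := by
    rw [taylorSystem_zero, taylorSystem_single, haf]
    exact LinearMap.ext fun x => taylorHomotopy_homotopy m (f j) x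
  higher u hu := by
    -- Either one index has degree at least 2 and its map vanishes, or both are standard basis
    -- vectors; then b is paired with its swap.
    have hswap : ∀ b ∈ Finset.HasAntidiagonal.antidiagonal u,
        taylorSystem m f b.1 * taylorSystem m f b.2 +
          taylorSystem m f b.2 * taylorSystem m f b.1 = 0 ∧
        (b.1 = b.2 → taylorSystem m f b.1 * taylorSystem m f b.2 = 0) := by
      rintro ⟨b, b'⟩ hb
      rw [Finset.HasAntidiagonal.mem_antidiagonal] at hb
      simp only at hb ⊢
      have hdeg : b.degree + b'.degree = u.degree := by rw [← hb, map_add]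
      rcases lt_or_ge b.degree 2 with h | h
      swap
      · simp [taylorSystem_eq_zero m f h]
      rcases lt_or_ge b'.degree 2 with h' | h'
      swap
      · simp [taylorSystem_eq_zero m f h']
      obtain ⟨i, rfl⟩ := exists_eq_single_of_degree_eq_one (show b.degree = 1 by omega)
      obtain ⟨j, rfl⟩ := exists_eq_single_of_degree_eq_one (show b'.degree = 1 by omega)
      rw [taylorSystem_single, taylorSystem_single]
      refine ⟨LinearMap.ext fun x => ?_, fun hij => LinearMap.ext fun x => ?_⟩
      · rw [LinearMap.add_apply, Module.End.mul_apply, Module.End.mul_apply, taylorHomotopy_comm,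
          LinearMap.zero_apply]
      · rw [Finsupp.single_left_inj one_ne_zero] at hij
        rw [hij, Module.End.mul_apply, taylorHomotopy_sq, LinearMap.zero_apply]
    exact sum_antidiagonal_eq_zero u _ (fun b hb => (hswap b hb).1) fun b hb => (hswap b hb).2

theorem taylorDifferential_apply_empty (m : Fin r → Fin n →₀ ℕ) (y : Taylor k n r) :
    taylorDifferential k m y ∅ = ∑ t, y {t} * mono k (m t) := by
  have h := congr_fun (taylorEmb_differential m y) ∅
  simpa [taylorEmb_apply, ann_apply, lcmExp, sgn, mono, bot_eq_zero, Finset.sum_apply, mul_comm] using h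

/-- Every basis element that occurs contains the inserted index, so the homotopies do not affect the
cokernel in degree 0. -/
theorem taylorHomotopy_apply_empty (m : Fin r → Fin n →₀ ℕ) (f : Fin r → MvPolynomial (Fin n) k)
    (y : Taylor k n r) : taylorHomotopy m f y ∅ = 0 := by
  have h := congr_fun (taylorEmb_homotopy m f y) ∅
  simpa [taylorEmb_apply, cre_apply, mono_ne_zero, Finset.sum_apply] using h

theorem exists_taylorDifferential_eq (m : Fin r → Fin n →₀ ℕ) {q : MvPolynomial (Fin n) k}
    (hq : q ∈ Ideal.span (Set.range fun j => mono k (m j))) :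
    ∃ y ∈ taylorGrading k n r 1, taylorDifferential k m y = Finsupp.single ∅ q := by
  obtain ⟨g, rfl⟩ := (Submodule.mem_span_range_iff_exists_fun _).1 hq
  have hy : ∑ t, Finsupp.single {t} (g t) ∈ taylorGrading k n r 1 := by
    refine sum_mem fun t _ => mem_taylorGrading.2 fun S hS => ?_
    rcases eq_or_ne S {t} with rfl | h
    · simp
    · exact absurd (by simp [h]) hS
  refine ⟨_, hy, ?_⟩
  ext1 S
  rcases eq_or_ne S ∅ with rfl | hS
  · rw [taylorDifferential_apply_empty, Finsupp.single_eq_same]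
    refine Finset.sum_congr rfl fun t _ => ?_
    simp [Finsupp.finsetSum_apply, Finsupp.single_apply]
  · rw [Finsupp.single_eq_of_ne hS]
    by_contra h
    have := mem_taylorGrading.1 (taylorDifferential_mem m hy) S h
    simp [hS] at this

end TaylorRelComplex

/-! ### The Shamash construction as a quotient of a module of functions over Q. -/

section ShamashPresentation

variable {k : Type*} [Field k] {n r c : ℕ}

/-- The basis `y^(v) ⊗ ε_S ⊗ 1` of `Φ(T)`. -/
def shamashBasis (k : Type*) [Field k] (n r c : ℕ) (R : Type*) [CommRing R]
    [Algebra (MvPolynomial (Fin n) k) R] :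
    Module.Basis ((Fin c →₀ ℕ) × Finset (Fin r)) R
      (Shamash (Q := MvPolynomial (Fin n) k) R c (Taylor k n r)) :=
  (Finsupp.basisSingleOne.tensorProduct Finsupp.basisSingleOne).baseChange R

variable {R : Type*} [CommRing R] [Algebra (MvPolynomial (Fin n) k) R]

theorem shamashBasis_apply (v : Fin c →₀ ℕ) (S : Finset (Fin r)) :
    shamashBasis k n r c R (v, S) = 1 ⊗ₜ (divPow _ v ⊗ₜ Finsupp.single S 1) := by
  simp [shamashBasis, divPow]

theorem shamashGrading_eq_span (l : ℤ) :
    shamashGrading R c (taylorGrading k n r) l = Submodule.span R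
      (shamashBasis k n r c R '' {p | 2 * (p.1.degree : ℤ) + (p.2.card : ℤ) = l}) := by
  apply le_antisymm
  · rw [shamashGrading, Submodule.span_le]
    rintro _ ⟨v, i, g, hg, hl, rfl⟩
    rw [taylorGrading_eq_span] at hg
    induction hg using Submodule.span_induction with
    | mem g hg =>
      obtain ⟨S, hS, rfl⟩ := hg
      refine Submodule.subset_span ⟨(v, S), ?_, ?_⟩
      · rw [Set.mem_ofPred_eq] at hS ⊢; rw [← hl, hS]
      · simp [shamashBasis_apply]
    | zero => simp
    | add x y _ _ hx hy =>
      rw [TensorProduct.tmul_add, TensorProduct.tmul_add]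
      exact add_mem hx hy
    | smul q x _ hx =>
      rw [TensorProduct.tmul_smul, TensorProduct.tmul_smul, ← algebraMap_smul R]
      exact Submodule.smul_mem _ _ hx
  · rw [Submodule.span_le]
    rintro _ ⟨⟨v, S⟩, hl, rfl⟩
    refine Submodule.subset_span ⟨v, S.card, Finsupp.single S 1, ?_, hl, shamashBasis_apply v S⟩
    exact Finsupp.single_mem_supported _ _ rfl

theorem shamashGrading_isInternal :
    DirectSum.IsInternal (shamashGrading R c (taylorGrading k n r)) := by
  have h := isInternal_span_basis (shamashBasis k n r c R)
    (fun p => 2 * (p.1.degree : ℤ) + (p.2.card : ℤ))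
  rwa [← funext shamashGrading_eq_span] at h

theorem shamashGrading_free (l : ℤ) :
    Module.Free R (shamashGrading R c (taylorGrading k n r) l) := by
  rw [shamashGrading_eq_span]
  exact free_span_basis (shamashBasis k n r c R) _

/-- The projection of `Q{y₁, …, y_c} ⊗ T`, as a module of functions, onto `Φ(T)`. -/
def shamashProj (k : Type*) [Field k] (n r c : ℕ) (R : Type*) [CommRing R]
    [Algebra (MvPolynomial (Fin n) k) R] : ((Fin c →₀ ℕ) →₀ Taylor k n r)
    →ₗ[MvPolynomial (Fin n) k] Shamash (Q := MvPolynomial (Fin n) k) R c (Taylor k n r) :=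
  TensorProduct.mk _ R _ 1 ∘ₗ
    (TensorProduct.finsuppScalarLeft (MvPolynomial (Fin n) k) (Taylor k n r)
      (Fin c →₀ ℕ)).symm.toLinearMap

theorem shamashProj_single (v : Fin c →₀ ℕ) (g : Taylor k n r) :
    shamashProj k n r c R (Finsupp.single v g) = 1 ⊗ₜ (divPow _ v ⊗ₜ g) := by
  simp [shamashProj, divPow]

/-- In coordinates the projection is reduction of coefficients, which determines its kernel. -/
theorem shamashBasis_repr_shamashProj (x : (Fin c →₀ ℕ) →₀ Taylor k n r) (v : Fin c →₀ ℕ)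
    (S : Finset (Fin r)) :
    (shamashBasis k n r c R).repr (shamashProj k n r c R x) (v, S) = algebraMap _ R (x v S) := by
  induction x using Finsupp.induction_linear with
  | zero => simp
  | add x y hx hy => simp [hx, hy]
  | single w g =>
    rw [shamashProj_single, shamashBasis, Module.Basis.baseChange_repr_tmul,
      Module.Basis.tensorProduct_repr_tmul_apply, Algebra.smul_def, mul_one]
    congr 1
    rcases eq_or_ne v w with rfl | h
    · simp [divPow]
    · simp [divPow, h]

theorem shamashProj_totalMap (m : Fin r → Fin n →₀ ℕ) (f : Fin c → Fin r → MvPolynomial (Fin n) k)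
    (x : (Fin c →₀ ℕ) →₀ Taylor k n r) :
    shamashProj k n r c R (multiMap (taylorDifferential k m) (fun i => taylorHomotopy m (f i)) x) =
      shamashDifferential R (taylorSystem m f) (shamashProj k n r c R x) := by
  induction x using Finsupp.induction_linear with
  | zero => simp
  | add x y hx hy => simp only [map_add, hx, hy]
  | single v g =>
    rw [shamashProj_single, shamashDifferential, LinearMap.baseChange_tmul, totalMap,
      TensorProduct.lift.tmul, divPow, Finsupp.linearCombination_single, one_smul]
    simp only [LinearMap.sum_apply, LinearMap.comp_apply, TensorProduct.mk_apply,
      TensorProduct.tmul_sum, ← shamashProj_single]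
    rw [← map_sum]
    congr 1
    -- The contribution of one fixed u to the sum over the antidiagonal is T composed with the shift
    -- by u.
    have key : ∀ (u : Fin c →₀ ℕ) (T : Module.End (MvPolynomial (Fin n) k) (Taylor k n r))
        (w : Fin c →₀ ℕ), (∑ p ∈ Finset.HasAntidiagonal.antidiagonal v,
          Finsupp.single p.2 ((if p.1 = u then T else 0) g)) w =
            T (Finsupp.single v g (w + u)) := by
      intro u T w
      rw [Finsupp.finsetSum_apply]
      by_cases hv : v = w + u
      · rw [Finset.sum_eq_single (u, w)]
        · simp [hv]
        · rintro ⟨p, q⟩ hp hne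
          rcases eq_or_ne p u with rfl | h
          · rcases eq_or_ne q w with rfl | h'
            · exact absurd rfl hne
            · simp [h'.symm]
          · simp [h]
        · intro h
          exact absurd (Finset.HasAntidiagonal.mem_antidiagonal.2 (by rw [hv, add_comm])) h
      · rw [Finsupp.single_eq_of_ne (Ne.symm hv), map_zero]
        refine Finset.sum_eq_zero ?_
        rintro ⟨p, q⟩ hp
        rw [Finset.HasAntidiagonal.mem_antidiagonal] at hp
        rcases eq_or_ne p u with rfl | h
        · rw [Finsupp.single_eq_of_ne]
          rintro rfl
          exact hv (by rw [← hp, add_comm])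
        · simp [h]
    ext1 w
    rw [multiMap_apply]
    have h0 := key 0 (taylorDifferential k m) w
    rw [add_zero] at h0
    rw [← h0]
    simp only [← key]
    rw [← Finsupp.finsetSum_apply, ← Finsupp.add_apply, Finset.sum_comm, ← Finset.sum_add_distrib]
    congr 1
    refine Finset.sum_congr rfl fun p _ => ?_
    rw [taylorSystem_eq, LinearMap.add_apply, LinearMap.sum_apply, Finsupp.single_add,
      Finsupp.single_finsetSum]

theorem shamashProj_mem {l : ℤ} {x : (Fin c →₀ ℕ) →₀ Taylor k n r}
    (hx : x ∈ shiftGrading (fun v : Fin c →₀ ℕ => (v.degree : ℤ)) (taylorGrading k n r) l) :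
    shamashProj k n r c R x ∈ shamashGrading R c (taylorGrading k n r) l := by
  rw [← Finsupp.sum_single x, Finsupp.sum, map_sum]
  refine sum_mem fun v _ => ?_
  rw [shamashProj_single]
  exact Submodule.subset_span ⟨v, _, x v, hx v, by ring, rfl⟩

theorem exists_shamashProj_eq (hR : Function.Surjective (algebraMap (MvPolynomial (Fin n) k) R))
    {l : ℤ} {X : Shamash (Q := MvPolynomial (Fin n) k) R c (Taylor k n r)}
    (hX : X ∈ shamashGrading R c (taylorGrading k n r) l) :
    ∃ x ∈ shiftGrading (fun v : Fin c →₀ ℕ => (v.degree : ℤ)) (taylorGrading k n r) l,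
      shamashProj k n r c R x = X := by
  induction hX using Submodule.span_induction with
  | mem X hX =>
    obtain ⟨v, i, g, hg, rfl, rfl⟩ := hX
    refine ⟨Finsupp.single v g, fun w => ?_, shamashProj_single v g⟩
    rcases eq_or_ne w v with rfl | h
    · simpa using hg
    · simp [h]
  | zero => exact ⟨0, zero_mem _, map_zero _⟩
  | add X Y _ _ hX hY =>
    obtain ⟨x, hx, rfl⟩ := hX
    obtain ⟨y, hy, rfl⟩ := hY
    exact ⟨x + y, add_mem hx hy, map_add _ _ _⟩
  | smul s X _ hX =>
    obtain ⟨x, hx, rfl⟩ := hX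
    obtain ⟨q, rfl⟩ := hR s
    exact ⟨q • x, Submodule.smul_mem _ _ hx, by rw [map_smul, algebraMap_smul]⟩

theorem shamashProj_surjective
    (hR : Function.Surjective (algebraMap (MvPolynomial (Fin n) k) R)) :
    Function.Surjective (shamashProj k n r c R) := by
  intro X
  induction X using TensorProduct.induction_on with
  | zero => exact ⟨0, map_zero _⟩
  | add X Y hX hY =>
    obtain ⟨x, rfl⟩ := hX
    obtain ⟨y, rfl⟩ := hY
    exact ⟨x + y, map_add _ _ _⟩
  | tmul s Y =>
    obtain ⟨q, rfl⟩ := hR s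
    refine ⟨q • TensorProduct.finsuppScalarLeft _ _ _ Y, ?_⟩
    rw [map_smul, Algebra.algebraMap_eq_smul_one, ← TensorProduct.smul_tmul']
    simp [shamashProj]

end ShamashPresentation

/-! ### Descent to R and the resolution. -/

section Resolution

variable {k : Type*} [Field k] {n r c : ℕ} {R : Type*} [CommRing R]
  [Algebra (MvPolynomial (Fin n) k) R]

theorem shamashProj_eq_zero_iff {a : Fin c → MvPolynomial (Fin n) k}
    (hker : ∀ q, algebraMap (MvPolynomial (Fin n) k) R q = 0 ↔ q ∈ Ideal.span (Set.range a))
    {x : (Fin c →₀ ℕ) →₀ Taylor k n r} :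
    shamashProj k n r c R x = 0 ↔
      x ∈ coeffSubmodule (Fin c →₀ ℕ) (coeffSubmodule (Finset (Fin r)) (initialIdeal a c)) := by
  rw [← (shamashBasis k n r c _).repr.map_eq_zero_iff, Finsupp.ext_iff, Prod.forall,
    initialIdeal_last]
  refine forall₂_congr fun v S => ?_
  rw [shamashBasis_repr_shamashProj, Finsupp.zero_apply]
  exact hker _

theorem shamash_isFreeResolution (m : Fin r → Fin n →₀ ℕ) (a : Fin c → MvPolynomial (Fin n) k)
    (ha : RingTheory.Sequence.IsWeaklyRegular (MvPolynomial (Fin n) k) (List.ofFn a))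
    (f : Fin c → Fin r → MvPolynomial (Fin n) k)
    (haf : ∀ i, a i = ∑ j, f i j * mono k (m j))
    (hR : Function.Surjective (algebraMap (MvPolynomial (Fin n) k) R))
    (hker : ∀ q, algebraMap (MvPolynomial (Fin n) k) R q = 0 ↔ q ∈ Ideal.span (Set.range a)) :
    IsFreeResolution (shamashGrading R c (taylorGrading k n r))
      (shamashDifferential R (taylorSystem m f))
      (R ⧸ (Ideal.span (Set.range fun j => mono k (m j))).map (algebraMap _ R)) := by
  have hrel := taylor_relComplex m a ha f haf
  have haI : Ideal.span (Set.range a) ≤ Ideal.span (Set.range fun j => mono k (m j)) := by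
    rw [Ideal.span_le]
    rintro _ ⟨i, rfl⟩
    rw [SetLike.mem_coe, haf]
    exact sum_mem fun j _ => Ideal.mul_mem_left _ _ (Ideal.subset_span ⟨j, rfl⟩)
  -- Membership in IR can be tested over Q because I contains the kernel of Q → R.
  have hmem : ∀ q, algebraMap _ R q ∈ (Ideal.span (Set.range fun j => mono k (m j))).map
      (algebraMap _ R) ↔ q ∈ Ideal.span (Set.range fun j => mono k (m j)) := by
    refine fun q => ⟨fun h => ?_, Ideal.mem_map_of_mem _⟩
    obtain ⟨p, hp, hpq⟩ := (Ideal.mem_map_iff_of_surjective _ hR).1 h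
    rw [← sub_eq_zero, ← map_sub, hker] at hpq
    exact (Submodule.sub_mem_iff_right _ hp).1 (haI hpq)
  refine { internal := ?_, free := ?_, degree := ?_, sq_zero := ?_, bounded := ?_,
           exact_pos := ?_, augmentation := ?_ }
  · exact shamashGrading_isInternal
  · exact shamashGrading_free
  · intro l X hX
    obtain ⟨x, hx, rfl⟩ := exists_shamashProj_eq hR hX
    rw [← shamashProj_totalMap]
    exact shamashProj_mem (hrel.multiMap_mem hx)
  · refine LinearMap.ext fun X => ?_
    obtain ⟨x, rfl⟩ := shamashProj_surjective hR X
    rw [Module.End.mul_apply, ← shamashProj_totalMap, ← shamashProj_totalMap,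
      (shamashProj_eq_zero_iff hker).2 (hrel.multiMap_sq x), LinearMap.zero_apply]
  · intro l hl
    rw [shamashGrading_eq_span, Submodule.span_eq_bot]
    rintro _ ⟨⟨v, S⟩, hvS, rfl⟩
    simp only [Set.mem_ofPred_eq] at hvS
    omega
  · intro l hl X hX hdX
    obtain ⟨x, hx, rfl⟩ := exists_shamashProj_eq hR hX
    rw [← shamashProj_totalMap, shamashProj_eq_zero_iff hker] at hdX
    obtain ⟨y, hy, hyx⟩ := hrel.relExact_multiMap (taylor_relExact m a) l hl x hx hdX
    refine ⟨_, shamashProj_mem hy, ?_⟩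
    have h := (shamashProj_eq_zero_iff hker).2 hyx
    rw [map_sub, sub_eq_zero] at h
    rw [← shamashProj_totalMap, h]
  -- In degree 0 the only basis element is `y^(0) ⊗ ε_∅ ⊗ 1`; the augmentation reads off its
  -- coordinate modulo IR.
  · refine ⟨(Submodule.mkQ _ ∘ₗ ((shamashBasis k n r c _).coord (0, ∅))) ∘ₗ Submodule.subtype _,
      ?_, ?_⟩
    · intro z
      obtain ⟨s, rfl⟩ := Submodule.mkQ_surjective _ z
      refine ⟨⟨s • shamashBasis k n r c _ (0, ∅), Submodule.smul_mem _ _ ?_⟩, by simp⟩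
      rw [shamashGrading_eq_span]
      exact Submodule.subset_span ⟨(0, ∅), by simp, rfl⟩
    · rintro ⟨X, hX⟩
      obtain ⟨x, hx, rfl⟩ := exists_shamashProj_eq hR hX
      have hx0 : x = Finsupp.single 0 (Finsupp.single ∅ (x 0 ∅)) := by
        ext1 v
        ext1 S
        by_cases h : x v S = 0
        · rw [h]
          rcases eq_or_ne v 0 with rfl | hv
          · rcases eq_or_ne S ∅ with rfl | hS
            · simp [h]
            · simp [hS]
          · simp [hv]
        · have h1 := mem_taylorGrading.1 (hx v) S h
          beta_reduce at h1
          have hv : v = 0 := (Finsupp.degree_eq_zero_iff v).1 (by omega)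
          have hS : S = ∅ := Finset.card_eq_zero.1 (by omega)
          subst hv hS
          simp
      simp only [LinearMap.comp_apply, Submodule.subtype_apply, Module.Basis.coord_apply,
        Submodule.mkQ_apply, Submodule.Quotient.mk_eq_zero]
      rw [shamashBasis_repr_shamashProj, hmem]
      constructor
      · intro h
        obtain ⟨y, hy, hyx⟩ := exists_taylorDifferential_eq m h
        refine ⟨shamashProj k n r c _ (Finsupp.single 0 y), shamashProj_mem fun v => ?_, ?_⟩
        · rcases eq_or_ne v 0 with rfl | hv
          · simpa using hy
          · simp [hv]
        · rw [← shamashProj_totalMap, multiMap_single_zero, hyx, ← hx0]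
      · rintro ⟨Y, hY, hYX⟩
        obtain ⟨y, hy, rfl⟩ := exists_shamashProj_eq hR hY
        rw [← shamashProj_totalMap, ← sub_eq_zero, ← map_sub, shamashProj_eq_zero_iff hker] at hYX
        -- The coefficient of `ε_∅` in the boundary is a combination of the m_t, and it agrees with
        -- that of x modulo (a) ⊆ I.
        have h := hYX 0 ∅
        rw [initialIdeal_last, Finsupp.sub_apply, Finsupp.sub_apply, multiMap_apply,
          Finsupp.add_apply, Finsupp.finsetSum_apply,
          Finset.sum_eq_zero fun i _ => taylorHomotopy_apply_empty m (f i) _, add_zero,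
          taylorDifferential_apply_empty] at h
        rw [← (Submodule.sub_mem_iff_right _ ?_)]
        · exact haI h
        · exact sum_mem fun j _ => Ideal.mul_mem_left _ _ (Ideal.subset_span ⟨j, rfl⟩)

end Resolution

end TaylorCI

end

theorem mainTheorem1 {k : Type*} [Field k] (n r c : ℕ)
    (m : Fin r → Fin n →₀ ℕ)
    (I : Ideal (MvPolynomial (Fin n) k))
    (hI : I = Ideal.span (Set.range fun j => TaylorCI.mono k (m j)))
    (a : Fin c → MvPolynomial (Fin n) k)
    (ha : RingTheory.Sequence.IsRegular (MvPolynomial (Fin n) k) (List.ofFn a))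
    (f : Fin c → Fin r → MvPolynomial (Fin n) k)
    (haf : ∀ i, a i = ∑ j, f i j * TaylorCI.mono k (m j)) :
    TaylorCI.IsSystemOfHigherHomotopies a (TaylorCI.taylorGrading k n r)
      (TaylorCI.taylorDifferential k m) (TaylorCI.taylorSystem m f) ∧
    TaylorCI.IsFreeResolution
      (TaylorCI.shamashGrading (MvPolynomial (Fin n) k ⧸ Ideal.span (Set.range a)) c
        (TaylorCI.taylorGrading k n r))
      (TaylorCI.shamashDifferential (MvPolynomial (Fin n) k ⧸ Ideal.span (Set.range a))
        (TaylorCI.taylorSystem m f))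
      ((MvPolynomial (Fin n) k ⧸ Ideal.span (Set.range a)) ⧸
        I.map (Ideal.Quotient.mk (Ideal.span (Set.range a)))) := by
  subst hI
  exact ⟨TaylorCI.taylor_isSystemOfHigherHomotopies m a f haf,
    TaylorCI.shamash_isFreeResolution m a ha.toIsWeaklyRegular f haf
      Ideal.Quotient.mk_surjective fun _ => Ideal.Quotient.eq_zero_iff_mem⟩
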